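/- Let $\mathbb F_q$ be a finite field, let $\mathcal M$ (respectively $\mathcal M_n$) be the set of monic polynomials (respectively monic polynomials of degree $n$) in $\mathbb F_q[x]$, and write $e(t)=e^{2\pi i t}$. Let $\Lambda(P^k)=\deg P$ for $P$ monic irreducible and $k\ge 1$, and $\Lambda(F)=0$ for all other $F\in\mathcal M$. For a function $f:\mathcal M\to\mathbb C$ with $f(1)=1$ that is multiplicative (that is, $f(FG)=f(F)f(G)$ for coprime $F,G$), write $\mathcal F(z)=\sum_{F\in\mathcal M} f(F)z^{\deg F}=\prod_P\big(1+f(P)z^{\deg P}+f(P^2)z^{2\deg P}+\cdots\big)$, and define $\Lambda_f$, supported on the powers $P^k$ ($k\ge1$) of monic irreducibles $P$, by taking logarithmic derivatives of the Euler factors: $$ z\frac{d}{dz}\log\Big(\sum_{k\ge 0} f(P^k)z^{k\deg P}\Big)=\sum_{k\ge 1}\Lambda_f(P^k)z^{k\deg P} \quad\text{for every } P, \qquad\text{so that}\qquad z\frac{\mathcal F'}{\mathcal F}(z)=\sum_{F\in\mathcal M}\Lambda_f(F)z^{\deg F}. $$ Let $\mathcal C(1)$ be the class of such $f$ with $|\Lambda_f(F)|\le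 \Lambda(F)$ for all $F\in\mathcal M$. Put $\sigma(n)=q^{-n}\sum_{F\in\mathcal M_n}f(F)$ and $\sigma_\theta(n)=\sigma(n)e(-n\theta)$. For a given $n$, let $f^\perp=f^{\perp,n}$ be the multiplicative function with $f^\perp(1)=1$, $\Lambda_{f^\perp}(F)=\Lambda_f(F)$ if $\deg F<n$ and $\Lambda_{f^\perp}(F)=0$ if $\deg F\ge n$, and let $\mathcal F^\perp(z)=\sum_{F\in\mathcal M}f^\perp(F)z^{\deg F}$, which is an entire function. Theorem (Lipschitz estimate). There are absolute constants $C,A>0$ such that the following holds for every finite field $\mathbb F_q$, every $f\in\mathcal C(1)$ and every integer $n\ge 2$. Let $\theta\in[0,1)$ be such that $|\mathcal F^{\perp}(e(-\theta)/q)|$ is maximal (over all $\theta\in[0,1)$). Then for every integer $\ell$ with $1\le\ell\le n$, $$ |\sigma_\theta(n+\ell)-\sigma_\theta(n)|\le C\left(\Big(\frac{\ell}{n}\Big)^{1-\frac2\pi}\log\frac{2n}{\ell}+\frac{(\log n)^{A}}{n^{1-c_m}}\right), $$ where $m$ is the smallest positive odd integer that does not divide $\ell$, and $c_m=\dfrac{1}{m\sin(\pi/(2m))}$.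 -/

import Mathlib

noncomputable section

namespace FunctionFieldMean

open Polynomial

/-- The character `e(t) = exp(2πit)`. -/
def e (t : ℝ) : ℂ := Complex.exp (2 * Real.pi * Complex.I * t)

variable {K : Type*} [Field K]

/-- `F = P ^ k` with `P` a monic irreducible polynomial and `k ≥ 1`. -/
def IsPrimePower (F P : K[X]) (k : ℕ) : Prop :=
  P.Monic ∧ Irreducible P ∧ 0 < k ∧ F = P ^ k

open Classical in
/-- The function on `K[X]` with value `g P k` at `P ^ k`, for `P` monic irreducible and `k ≥ 1`,
and value `0` at all polynomials that are not of this form. -/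
def onPrimePowers {α : Type*} [Zero α] (g : K[X] → ℕ → α) (F : K[X]) : α :=
  if h : ∃ P k, IsPrimePower F P k then g h.choose h.choose_spec.choose else 0

/-- The representation of a prime power is unique. -/
theorem isPrimePower_unique {F P Q : K[X]} {j k : ℕ} (h1 : IsPrimePower F P j)
    (h2 : IsPrimePower F Q k) : P = Q ∧ j = k := by
  obtain ⟨hPm, hPi, hj, rfl⟩ := h1
  obtain ⟨hQm, hQi, hk, h⟩ := h2
  have hd : P ∣ Q ^ k := h ▸ dvd_pow_self P hj.ne'
  have hPQ : P ∣ Q := hPi.prime.dvd_of_dvd_pow hd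
  have hEq : P = Q := eq_of_monic_of_associated hPm hQm (hPi.associated_of_dvd hQi hPQ)
  subst hEq
  refine ⟨rfl, ?_⟩
  have h3 := congrArg natDegree h
  rw [natDegree_pow, natDegree_pow] at h3
  exact Nat.eq_of_mul_eq_mul_right hPi.natDegree_pos h3

theorem onPrimePowers_pow {α : Type*} [Zero α] (g : K[X] → ℕ → α) {P : K[X]} (hm : P.Monic)
    (hi : Irreducible P) {k : ℕ} (hk : 0 < k) : onPrimePowers g (P ^ k) = g P k := by
  have h0 : IsPrimePower (P ^ k) P k := ⟨hm, hi, hk, rfl⟩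
  have h : ∃ Q j, IsPrimePower (P ^ k) Q j := ⟨P, k, h0⟩
  obtain ⟨h1, h2⟩ := isPrimePower_unique h.choose_spec.choose_spec h0
  rw [onPrimePowers, dif_pos h]
  exact congrArg₂ g h1 h2

theorem onPrimePowers_of_not {α : Type*} [Zero α] (g : K[X] → ℕ → α) {F : K[X]}
    (h : ¬ ∃ P k, IsPrimePower F P k) : onPrimePowers g F = 0 := dif_neg h

/-- The von Mangoldt function: `Λ(P ^ k) = deg P`, and `Λ(F) = 0` otherwise. -/
def vonMangoldt : K[X] → ℝ := onPrimePowers fun P _ => (P.natDegree : ℝ)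

/-- Multiplicative functions on monic polynomials (values elsewhere are irrelevant). -/
def IsMultiplicative (f : K[X] → ℂ) : Prop :=
  ∀ F G : K[X], F.Monic → G.Monic → IsCoprime F G → f (F * G) = f F * f G

/-- The Euler factor `∑ₖ f(P ^ k) T ^ k` at `P`, where `T` stands for `z ^ deg P`. -/
def eulerFactor (f : K[X] → ℂ) (P : K[X]) : PowerSeries ℂ :=
  PowerSeries.mk fun k => f (P ^ k)

/-- The coefficients `Λ_f(F)` of `z ℱ'(z) / ℱ(z) = ∑_F Λ_f(F) z ^ deg F`. They are supported on
prime powers; as `ℱ` is the product of its Euler factors `E_P(z ^ deg P)`, the part of the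
logarithmic derivative coming from `P` is `deg P * (T E_P'(T) / E_P(T))` at `T = z ^ deg P`. -/
def lambda (f : K[X] → ℂ) : K[X] → ℂ :=
  onPrimePowers fun P k =>
    (P.natDegree : ℂ) * PowerSeries.coeff k
      (PowerSeries.X * PowerSeries.derivative ℂ (eulerFactor f P) * (eulerFactor f P)⁻¹)

/-- The class `𝒞(κ)`. -/
structure InClass (κ : ℝ) (f : K[X] → ℂ) : Prop where
  mult : IsMultiplicative f
  map_one : f 1 = 1
  norm_lambda_le : ∀ F : K[X], F.Monic → ‖lambda f F‖ ≤ κ * vonMangoldt F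

theorem finite_monic_natDegree (K : Type*) [Field K] [Finite K] (n : ℕ) :
    {F : K[X] | F.Monic ∧ F.natDegree = n}.Finite := by
  have hfin : Finite (degreeLT K (n + 1)) := Finite.of_equiv _ (degreeLTEquiv K (n + 1)).toEquiv.symm
  refine (Set.toFinite (degreeLT K (n + 1) : Set K[X])).subset ?_
  rintro F ⟨-, hF⟩
  rw [SetLike.mem_coe, mem_degreeLT]
  exact lt_of_le_of_lt degree_le_natDegree (by rw [hF]; exact_mod_cast Nat.lt_succ_self n)

/-- The finite set `ℳₙ` of monic polynomials of degree `n` over a finite field. -/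
def monics (K : Type*) [Field K] [Finite K] (n : ℕ) : Finset K[X] :=
  (finite_monic_natDegree K n).toFinset

theorem mem_monics [Finite K] {n : ℕ} {F : K[X]} :
    F ∈ monics K n ↔ F.Monic ∧ F.natDegree = n := by simp [monics]

/-- The mean value `σ(n) = q ^ (-n) ∑_{F ∈ ℳₙ} f(F)`, with `q = |K|`. -/
def sigma [Finite K] (f : K[X] → ℂ) (n : ℕ) : ℂ :=
  (∑ F ∈ monics K n, f F) / (Nat.card K : ℂ) ^ n

/-- The twisted mean value `σ_θ(n) = σ(n) e(-nθ)`. -/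
def sigmaTwist [Finite K] (f : K[X] → ℂ) (θ : ℝ) (n : ℕ) : ℂ :=
  sigma f n * e (-(n * θ))

/-- `Λ_f` cut off at degree `n`. -/
def truncLambda (f : K[X] → ℂ) (n : ℕ) (F : K[X]) : ℂ :=
  if F.natDegree < n then lambda f F else 0

/-- The power series `∑_{k ≥ 1} L(P ^ k) / (k deg P) T ^ k`
(the constant coefficient is `0`, by division by zero). -/
def localLog (L : K[X] → ℂ) (P : K[X]) : PowerSeries ℂ :=
  PowerSeries.mk fun k => L (P ^ k) / (k * P.natDegree)

/-- The exponential of `localLog L P`: the Euler factor at `P` of the multiplicative function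
whose `Λ`-coefficients are given by `L`. -/
def localExp (L : K[X] → ℂ) (P : K[X]) : PowerSeries ℂ :=
  (PowerSeries.exp ℂ).subst (localLog L P)

open Classical in
/-- The multiplicative function with `Λ`-coefficients `L`. -/
def ofLambda (L : K[X] → ℂ) (F : K[X]) : ℂ :=
  ∏ P ∈ (UniqueFactorizationMonoid.normalizedFactors F).toFinset,
    PowerSeries.coeff ((UniqueFactorizationMonoid.normalizedFactors F).count P) (localExp L P)

/-- The multiplicative function `f^⊥ = f^{⊥,n}`, for which `Λ_{f^⊥}(F)` is `Λ_f(F)` if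
`deg F < n`, and `0` otherwise (see `lambda_perp`). -/
def perp (f : K[X] → ℂ) (n : ℕ) : K[X] → ℂ := ofLambda (truncLambda f n)

/-- The generating function `∑_F f(F) z ^ deg F`, summed over all monic polynomials `F`. -/
def genFun (f : K[X] → ℂ) (z : ℂ) : ℂ :=
  ∑' F : {F : K[X] // F.Monic}, f F * z ^ (F : K[X]).natDegree

/-- The constant `c_m = 1 / (m sin(π / (2m)))`. -/
def c (m : ℕ) : ℝ := 1 / (m * Real.sin (Real.pi / (2 * m)))

theorem constantCoeff_localLog (L : K[X] → ℂ) (P : K[X]) :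
    PowerSeries.constantCoeff (localLog L P) = 0 := by
  simp [localLog, ← PowerSeries.coeff_zero_eq_constantCoeff_apply]

theorem hasSubst_localLog (L : K[X] → ℂ) (P : K[X]) :
    PowerSeries.HasSubst (localLog L P) :=
  PowerSeries.HasSubst.of_constantCoeff_zero' (constantCoeff_localLog L P)

theorem constantCoeff_localExp (L : K[X] → ℂ) (P : K[X]) :
    PowerSeries.constantCoeff (localExp L P) = 1 := by
  rw [← PowerSeries.coeff_zero_eq_constantCoeff_apply, localExp,
    PowerSeries.coeff_subst' (hasSubst_localLog L P), finsum_eq_single _ 0]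
  · simp
  · intro d hd
    simp [constantCoeff_localLog, hd]

theorem derivative_localExp (L : K[X] → ℂ) (P : K[X]) :
    PowerSeries.derivative ℂ (localExp L P) =
      localExp L P * PowerSeries.derivative ℂ (localLog L P) := by
  rw [localExp, PowerSeries.derivative_subst (hasSubst_localLog L P), PowerSeries.derivative_exp]

theorem ofLambda_one (L : K[X] → ℂ) : ofLambda L 1 = 1 := by
  simp [ofLambda]

theorem eulerFactor_ofLambda (L : K[X] → ℂ) {P : K[X]} (hm : P.Monic) (hi : Irreducible P) :
    eulerFactor (ofLambda L) P = localExp L P := by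
  classical
  ext k
  rw [eulerFactor, PowerSeries.coeff_mk]
  rcases Nat.eq_zero_or_pos k with rfl | hk
  · rw [pow_zero, ofLambda_one, PowerSeries.coeff_zero_eq_constantCoeff_apply,
      constantCoeff_localExp]
  · have h : UniqueFactorizationMonoid.normalizedFactors (P ^ k) = Multiset.replicate k P := by
      rw [UniqueFactorizationMonoid.normalizedFactors_pow,
        UniqueFactorizationMonoid.normalizedFactors_irreducible hi, hm.normalize_eq_self,
        Multiset.nsmul_singleton]
    simp only [ofLambda]
    convert_to ∏ Q ∈ (Multiset.replicate k P).toFinset,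
      PowerSeries.coeff ((Multiset.replicate k P).count Q) (localExp L Q) = _
    · rw [h]
    · rw [Multiset.toFinset_replicate, if_neg hk.ne', Finset.prod_singleton,
        Multiset.count_replicate_self]

/-- If `L` is supported on prime powers, then `ofLambda L` has `Λ`-coefficients `L`. -/
theorem lambda_ofLambda (L : K[X] → ℂ) (hL : ∀ F, (¬ ∃ P k, IsPrimePower F P k) → L F = 0) :
    lambda (ofLambda L) = L := by
  funext F
  by_cases h : ∃ P k, IsPrimePower F P k
  · obtain ⟨P, k, hm, hi, hk, rfl⟩ := h
    rw [lambda, onPrimePowers_pow _ hm hi hk, eulerFactor_ofLambda L hm hi, derivative_localExp]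
    have hu : localExp L P * (localExp L P)⁻¹ = 1 :=
      PowerSeries.mul_inv_cancel _ (by rw [constantCoeff_localExp]; exact one_ne_zero)
    have h1 : PowerSeries.X * (localExp L P * PowerSeries.derivative ℂ (localLog L P)) *
        (localExp L P)⁻¹ = PowerSeries.X * PowerSeries.derivative ℂ (localLog L P) := by
      calc _ = PowerSeries.X * PowerSeries.derivative ℂ (localLog L P) *
            (localExp L P * (localExp L P)⁻¹) := by ring
        _ = _ := by rw [hu, mul_one]
    rw [h1]
    obtain ⟨j, rfl⟩ : ∃ j, k = j + 1 := ⟨k - 1, by omega⟩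
    rw [PowerSeries.coeff_succ_X_mul, PowerSeries.coeff_derivative, localLog,
      PowerSeries.coeff_mk]
    have hd : (P.natDegree : ℂ) ≠ 0 := by exact_mod_cast hi.natDegree_pos.ne'
    have hj : (j : ℂ) + 1 ≠ 0 := by exact_mod_cast Nat.succ_ne_zero j
    push_cast
    field_simp
  · rw [lambda, onPrimePowers_of_not _ h, hL F h]

/-- The defining property of `f^⊥`. -/
theorem lambda_perp (f : K[X] → ℂ) (n : ℕ) (F : K[X]) :
    lambda (perp f n) F = if F.natDegree < n then lambda f F else 0 := by
  rw [perp, lambda_ofLambda]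
  · rfl
  · intro G hG
    rw [truncLambda, lambda, onPrimePowers_of_not _ hG, ite_self]

theorem isMultiplicative_perp (f : K[X] → ℂ) (n : ℕ) : IsMultiplicative (perp f n) := by
  classical
  intro F G hF hG hFG
  have hdis : Disjoint (UniqueFactorizationMonoid.normalizedFactors F)
      (UniqueFactorizationMonoid.normalizedFactors G) :=
    (UniqueFactorizationMonoid.disjoint_normalizedFactors hFG.isRelPrime)
  have hmul := UniqueFactorizationMonoid.normalizedFactors_mul hF.ne_zero hG.ne_zero
  simp only [perp, ofLambda]
  rw [hmul]
  simp only [Multiset.toFinset_add, Multiset.count_add]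
  have hd' : Disjoint (UniqueFactorizationMonoid.normalizedFactors F).toFinset
      (UniqueFactorizationMonoid.normalizedFactors G).toFinset := by
    rw [Multiset.disjoint_toFinset]; exact hdis
  convert Finset.prod_union hd' using 2
  · refine Finset.prod_congr (by congr!) fun P hP => ?_
    have : P ∉ UniqueFactorizationMonoid.normalizedFactors G := fun h =>
      Multiset.disjoint_left.mp hdis (Multiset.mem_toFinset.mp hP) h
    rw [Multiset.count_eq_zero_of_notMem this, add_zero]
  · refine Finset.prod_congr (by congr!) fun P hP => ?_
    have : P ∉ UniqueFactorizationMonoid.normalizedFactors F := fun h =>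
      Multiset.disjoint_left.mp hdis h (Multiset.mem_toFinset.mp hP)
    rw [Multiset.count_eq_zero_of_notMem this, zero_add]

end FunctionFieldMean

end

noncomputable section

namespace FunctionFieldMean
open Real Set

/-! ### Fourier expansion of `|cos (π x)|` -/

/-! The problem reduces to one about sequences. Let χ(k) = `chi f k` be the mean of Λ_f over degree
k. The identity f(F) deg F = ∑_{G ∣ F} Λ_f(G) f(F/G) gives j σ(j) = ∑_{k ≤ j} χ(k) σ(j - k)
(`isExpSeq_sigma`), so that formally ∑ σ(j) z^j = exp(∑ χ(k) z^k / k), and |χ(k)| ≤ 1 by the prime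
polynomial theorem. On |z| = 1, ℱ^⊥(z/q) is E(z) = exp(∑_{k<n} χ(k) z^k / k) (`genFun_perp`).
Twisting by e(-kθ) moves the maximum of |E| to z = 1. The field has then disappeared, which is why
the constants are absolute.

Up to O(l/n), σ(n+l) - σ(n) is the coefficient of z^(n+l) in H(z) = (1 - z^l) E(z). Halász's method
(`norm_coeff_one_sub_mul_expSeries_le`): the recursion coming from z H' expresses this coefficient
through the coefficients h(j) of H with l < j < n + l. These are cut into O(log(2n/l)) dyadic
blocks, and the recursion is applied again inside each block. What remains are bilinear forms with
Toeplitz matrix h(j - b), controlled by M = max |H| on |z| = 1. The total is O((M + l) log(2n/l) /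
n).

To bound M, maximality at 1 gives |E(z)|² ≤ |E(z) E(1)|, and |1 + e(kα)| = 2|cos πkα| turns this
into |E(e(α))| ≤ exp(∑_{k<n} |cos πkα| / k). Expand |cos πx| in its Fourier series, of mean 2/π, and
approximate α = b/r + β with r at most a power of log n. Only frequencies divisible by r resonate,
and up to powers of log n the bound is n^(2/π) min(n, 1/(r|β|))^(d_r), with d_r = c_r - 2/π for odd
r and d_r ≤ 0 for even r. If r is even or r ≥ m, this is at most n^(c_m) times a power of log n. If
r is odd and r < m, then r ∣ l, so |1 - e(lα)| = |1 - e(lβ)| is small near β = 0. The worst case r =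
1 produces n^(2/π) l^(1-2/π) (`exists_norm_one_sub_mul_exp_le`). -/

theorem integral_exp_mul_cos {a : ℝ} (ha : 0 < a) (ha' : a ≤ 1 / 2) (n : ℤ) :
    ∫ x in (-1 / 2 : ℝ)..(1 / 2), Complex.exp (2 * π * Complex.I * ((-n : ℤ) : ℂ) * x) *
      (cos (2 * π * a * x) : ℂ) =
      ((-1) ^ n * (sin (π * a) * a / (π * (a ^ 2 - n ^ 2))) : ℝ) := by
  have h1 : (a - n : ℝ) ≠ 0 := by
    intro h
    have h2 : a = n := by linarith
    have h3 : (0 : ℝ) < n := h2 ▸ ha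
    have h4 : (n : ℝ) < 1 := by rw [← h2]; linarith
    norm_cast at h3 h4
    omega
  have h2 : (a + n : ℝ) ≠ 0 := by
    intro h
    have h2 : a = (-n : ℤ) := by push_cast; linarith
    have h3 : (0 : ℝ) < (-n : ℤ) := h2 ▸ ha
    have h4 : ((-n : ℤ) : ℝ) < 1 := by rw [← h2]; linarith
    norm_cast at h3 h4
    omega
  have h1' : (a - n : ℂ) ≠ 0 := by exact_mod_cast h1
  have h2' : (a + n : ℂ) ≠ 0 := by exact_mod_cast h2
  have hπ : (π : ℂ) ≠ 0 := by exact_mod_cast pi_ne_zero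
  have e1 : ∀ x : ℝ, Complex.exp (2 * π * Complex.I * ((-n : ℤ) : ℂ) * x) *
      (cos (2 * π * a * x) : ℂ) =
      (1 / 2) * Complex.exp ((2 * π * Complex.I * (a - n)) * x) +
      (1 / 2) * Complex.exp ((-(2 * π * Complex.I * (a + n))) * x) := by
    intro x
    rw [Complex.ofReal_cos, Complex.cos, mul_div_assoc', mul_add, ← Complex.exp_add,
      ← Complex.exp_add, add_div, div_eq_inv_mul, div_eq_inv_mul, one_div]
    congr 3 <;> (push_cast; ring)
  simp_rw [e1]
  rw [intervalIntegral.integral_add, intervalIntegral.integral_const_mul,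
    intervalIntegral.integral_const_mul, integral_exp_mul_complex, integral_exp_mul_complex]
  · have key : ∀ s : ℂ, Complex.exp (2 * π * Complex.I * s * (1 / 2 : ℝ)) -
        Complex.exp (2 * π * Complex.I * s * (-1 / 2 : ℝ)) = 2 * Complex.I * Complex.sin (π * s) := by
      intro s
      rw [Complex.sin]
      have : Complex.I * Complex.I = -1 := Complex.I_mul_I
      rw [show 2 * π * Complex.I * s * (1 / 2 : ℝ) = π * s * Complex.I by push_cast; ring,
        show 2 * π * Complex.I * s * (-1 / 2 : ℝ) = -(π * s) * Complex.I by push_cast; ring]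
      linear_combination (Complex.exp (π * s * Complex.I) - Complex.exp (-(π * s) * Complex.I)) * this
    rw [show (-(2 * π * Complex.I * (a + n)) : ℂ) = 2 * π * Complex.I * (-(a + n)) by ring, key, key]
    have s1 : Complex.sin (π * (a - n)) = (-1) ^ n * Complex.sin (π * a) := by
      rw [show (π * (a - n) : ℂ) = π * a - n * π by ring]
      have := congrArg Complex.ofReal (Real.sin_sub_int_mul_pi (π * a) n)
      push_cast at this
      exact this
    have s2 : Complex.sin (π * -(a + n)) = -((-1) ^ n * Complex.sin (π * a)) := by
      rw [show (π * -(a + n) : ℂ) = -(π * a + n * π) by ring, Complex.sin_neg]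
      have := congrArg (fun x => -Complex.ofReal x) (Real.sin_add_int_mul_pi (π * a) n)
      push_cast at this
      exact this
    rw [s1, s2]
    have h3 : (a ^ 2 - n ^ 2 : ℂ) ≠ 0 := by
      rw [show (a ^ 2 - n ^ 2 : ℂ) = (a - n) * (a + n) by ring]; exact mul_ne_zero h1' h2'
    push_cast
    have hI := Complex.I_ne_zero
    have h4 : (-n - a : ℂ) ≠ 0 := by
      rw [show (-n - a : ℂ) = -(a + n) by ring]; exact neg_ne_zero.mpr h2'
    rw [show (a ^ 2 - n ^ 2 : ℂ) = (a - n) * (a + n) by ring]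
    field_simp
    ring
  · simp [hπ, Complex.I_ne_zero]
    exact fun h => h2' (by linear_combination h)
  · simp [hπ, Complex.I_ne_zero, h1']
  · exact Continuous.intervalIntegrable (by fun_prop) _ _
  · exact Continuous.intervalIntegrable (by fun_prop) _ _

/-- The coefficients of the Fourier expansion of `cos (2πax)` on `[-1/2, 1/2]`. -/
theorem hasSum_cos {a : ℝ} (ha : 0 < a) (ha' : a ≤ 1 / 2) {x : ℝ} (hx : -1 / 2 ≤ x)
    (hx' : x < 1 / 2) :
    HasSum (fun j : ℕ => 2 * ((-1) ^ j * (sin (π * a) * a / (π * (a ^ 2 - j ^ 2)))) *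
      cos (2 * π * j * x)) (cos (2 * π * a * x) + sin (π * a) / (π * a)) := by
  have : Fact ((0 : ℝ) < 1) := ⟨one_pos⟩
  set f : ℝ → ℂ := fun x => (cos (2 * π * a * x) : ℂ) with hf
  -- Continuity on the circle holds because the cosine is even, so the values at -1/2 and 1/2 agree.
  have hcont : Continuous (AddCircle.liftIco (1 : ℝ) (-1 / 2) f) := by
    apply AddCircle.liftIco_continuous
    · simp only [hf]
      rw [show (2 * π * a * (-1 / 2 + 1)) = -(2 * π * a * (-1 / 2)) by ring, cos_neg]
    · exact Continuous.continuousOn (by fun_prop)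
  set g : C(AddCircle (1 : ℝ), ℂ) := ⟨_, hcont⟩ with hg
  set b : ℤ → ℝ := fun n => (-1) ^ n * (sin (π * a) * a / (π * (a ^ 2 - n ^ 2))) with hb
  have hcoef : ∀ n : ℤ, fourierCoeff g n = (b n : ℂ) := by
    intro n
    change fourierCoeff (AddCircle.liftIco (1 : ℝ) (-1 / 2) f) n = _
    rw [fourierCoeff_liftIco_eq, fourierCoeffOn_eq_integral, hb, ← integral_exp_mul_cos ha ha' n]
    simp only [fourier_coe_apply, hf]
    norm_num
  have hsum : Summable (fourierCoeff g) := by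
    have h0 : Summable fun n : ℤ => |1 / (n : ℝ) ^ 2| :=
      (Real.summable_one_div_int_pow.mpr (by norm_num : 1 < 2)).abs
    have h1 : Summable fun n : ℤ => (sin (π * a) * a / π * (4/3)) * |1 / (n : ℝ) ^ 2| := h0.mul_left _
    refine Summable.of_norm_bounded_eventually h1 ?_
    rw [Filter.eventually_cofinite]
    refine (Set.finite_singleton (0 : ℤ)).subset ?_
    intro n hn
    by_contra hn0
    apply hn
    have hn0' : n ≠ 0 := hn0
    rw [hcoef, Complex.norm_real, hb]
    have hs : 0 ≤ sin (π * a) := sin_nonneg_of_nonneg_of_le_pi (by positivity)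
      (by nlinarith [pi_pos])
    have hn1 : (1 : ℝ) ≤ (n : ℝ) ^ 2 := by
      have : (1 : ℤ) ≤ n ^ 2 := by
        have := sq_abs n
        have h : 1 ≤ |n| := Int.one_le_abs hn0'
        nlinarith
      exact_mod_cast this
    have hpos : 0 < (n : ℝ) ^ 2 - a ^ 2 := by nlinarith
    -- The factor 4/3 comes from a² ≤ 1/4 ≤ n²/4.
    have hle : 1 / ((n : ℝ) ^ 2 - a ^ 2) ≤ 4 / 3 * (1 / (n : ℝ) ^ 2) := by
      rw [mul_one_div, div_le_div_iff₀ hpos (by linarith)]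
      nlinarith
    have habs : ‖(-1 : ℝ) ^ n * (sin (π * a) * a / (π * (a ^ 2 - n ^ 2)))‖ =
        sin (π * a) * a / π * (1 / ((n : ℝ) ^ 2 - a ^ 2)) := by
      rw [norm_mul, norm_zpow, norm_neg, norm_one, one_zpow, one_mul,
        ← neg_sub ((n : ℝ) ^ 2), mul_neg, div_neg, norm_neg, Real.norm_of_nonneg (by positivity),
        mul_one_div, div_div]
    rw [habs, abs_of_nonneg (by positivity), mul_assoc _ (4 / 3 : ℝ)]
    exact mul_le_mul_of_nonneg_left hle (by positivity)
  have h := has_pointwise_sum_fourier_series_of_summable hsum (x : AddCircle (1 : ℝ))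
  have hgx : g (x : AddCircle (1 : ℝ)) = f x := by
    change AddCircle.liftIco (1 : ℝ) (-1 / 2) f x = _
    rw [AddCircle.liftIco_coe_apply]
    constructor <;> linarith
  rw [hgx] at h
  -- Pairing n with -n counts n = 0 twice; the surplus is the term sin(πa)/(πa) in the sum.
  have h2 := h.nat_add_neg
  have h3 := Complex.hasSum_re h2
  have hre : ∀ n : ℤ, (fourierCoeff g n • fourier n (x : AddCircle (1 : ℝ))).re =
      b n * cos (2 * π * n * x) := by
    intro n
    rw [hcoef, fourier_coe_apply, smul_eq_mul, Complex.re_ofReal_mul,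
      show (2 * π * Complex.I * n * x / (1 : ℝ) : ℂ) = (2 * π * n * x : ℝ) * Complex.I by
        push_cast; ring, Complex.exp_ofReal_mul_I_re]
  convert h3 using 1
  · ext j
    rw [Complex.add_re, hre, hre, hb]
    simp only [Int.cast_natCast, Int.cast_neg, zpow_natCast, zpow_neg]
    rw [← inv_pow, inv_neg, inv_one, show 2 * π * -(j : ℝ) * x = -(2 * π * j * x) by ring, cos_neg]
    ring
  · rw [Complex.add_re, hre, hf, Complex.ofReal_re]
    simp [hb]
    field_simp

/-- The Fourier coefficients of `|cos (π x)|`, doubled, except that the mean value is left out. -/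
def cosCoeff (j : ℕ) : ℝ := if j = 0 then 0 else 4 / π * ((-1) ^ (j + 1) / (4 * (j : ℝ) ^ 2 - 1))

theorem abs_cosCoeff_le (j : ℕ) : |cosCoeff j| ≤ 1 / (j : ℝ) ^ 2 := by
  rw [cosCoeff]
  split_ifs with h
  · simp [h]
  · have hj : (1 : ℝ) ≤ (j : ℝ) ^ 2 := by
      have : 1 ≤ j := Nat.one_le_iff_ne_zero.mpr h
      exact_mod_cast Nat.one_le_pow _ _ this
    rw [abs_mul, abs_of_pos (by positivity : 0 < 4 / π), abs_div, abs_pow, abs_neg, abs_one, one_pow,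
      abs_of_pos (by linarith), div_mul_div_comm, mul_one,
      div_le_div_iff₀ (mul_pos pi_pos (by linarith)) (by linarith)]
    nlinarith [pi_gt_three]

/-- This is `hasSum_cos` at a = 1/2, where cos(πy) ≥ 0 on [-1/2, 1/2), extended by 1-periodicity. -/
theorem hasSum_abs_cos (x : ℝ) :
    HasSum (fun j : ℕ => cosCoeff j * cos (2 * π * j * x)) (|cos (π * x)| - 2 / π) := by
  have hper : ∀ y : ℝ, -1 / 2 ≤ y → y < 1 / 2 →
      HasSum (fun j : ℕ => cosCoeff j * cos (2 * π * j * y)) (|cos (π * y)| - 2 / π) := by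
    intro y hy hy'
    have h := hasSum_cos (a := 1 / 2) (by norm_num) le_rfl hy hy'
    rw [show sin (π * (1 / 2)) = 1 by rw [mul_one_div, sin_pi_div_two]] at h
    -- Dropping the term j = 0, which is 4/π, changes cos(πy) + 2/π into cos(πy) - 2/π.
    have h1 := h.update 0 0
    convert! h1 using 1
    · ext j
      rcases eq_or_ne j 0 with rfl | hj
      · simp [cosCoeff]
      · rw [Function.update_of_ne hj, cosCoeff, if_neg hj]
        have h4 : (4 * (j : ℝ) ^ 2 - 1) ≠ 0 := by
          have : (1 : ℝ) ≤ (j : ℝ) ^ 2 := by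
            exact_mod_cast Nat.one_le_pow _ _ (Nat.one_le_iff_ne_zero.mpr hj)
          linarith
        have h5 : ((1 / 2) ^ 2 - (j : ℝ) ^ 2) = -(4 * (j : ℝ) ^ 2 - 1) / 4 := by ring
        rw [h5, pow_succ]
        field_simp
    · rw [abs_of_nonneg]
      · simp only [pow_zero, Nat.cast_zero, mul_zero, zero_mul, cos_zero]
        rw [show 2 * π * (1 / 2) * y = π * y by ring]
        field_simp
        ring
      · apply cos_nonneg_of_neg_pi_div_two_le_of_le <;> nlinarith [pi_pos]
  have h := hper (x - ⌊x + 1 / 2⌋) (by linarith [Int.floor_le (x + 1 / 2)])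
    (by linarith [Int.lt_floor_add_one (x + 1 / 2)])
  convert h using 1
  · ext j
    rw [show 2 * π * j * (x - ⌊x + 1 / 2⌋) = 2 * π * j * x - ((j * ⌊x + 1 / 2⌋ : ℤ) : ℝ) * (2 * π) by
      push_cast; ring, cos_sub_int_mul_two_pi]
  · rw [mul_sub, mul_comm π (⌊x + 1 / 2⌋ : ℝ), cos_sub_int_mul_pi, abs_mul, abs_zpow, abs_neg, abs_one,
      one_zpow, one_mul]

/-- Up to the factor 1/(r sin(π/2r)), the coefficients at multiples of an odd r are those of
cos(2πax) with a = 1/(2r), evaluated at x = 0. Equivalently, c_r is the mean of |cos(πk/r)| over k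
modulo r. -/
theorem hasSum_cosCoeff_mul {r : ℕ} (hr : Odd r) :
    HasSum (fun i : ℕ => cosCoeff (r * i)) (c r - 2 / π) := by
  have hr1 : (1 : ℝ) ≤ r := by exact_mod_cast hr.pos
  have hr0 : (0 : ℝ) < r := by linarith
  have hs : sin (π * (1 / (2 * r))) ≠ 0 := by
    refine (sin_pos_of_pos_of_lt_pi (by positivity) ?_).ne'
    rw [mul_one_div]
    exact div_lt_self pi_pos (by linarith)
  have h := hasSum_cos (a := 1 / (2 * r)) (by positivity)
    (one_div_le_one_div_of_le (by norm_num) (by linarith)) (x := 0) (by norm_num) (by norm_num)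
  rw [c, show π / (2 * r) = π * (1 / (2 * r)) by ring]
  generalize hS : sin (π * (1 / (2 * r))) = S at hs h ⊢
  have h1 := (h.update 0 0).mul_left (1 / (r * S))
  convert! h1 using 1
  · ext i
    rcases eq_or_ne i 0 with rfl | hi
    · simp [cosCoeff]
    · rw [Function.update_of_ne hi, cosCoeff, if_neg (mul_ne_zero hr.pos.ne' hi), mul_zero, cos_zero]
      have h4 : (4 * (r * i : ℝ) ^ 2 - 1) ≠ 0 := by
        have : (1 : ℝ) ≤ (r * i : ℝ) ^ 2 := by
          exact_mod_cast Nat.one_le_pow _ _ (Nat.one_le_iff_ne_zero.mpr (mul_ne_zero hr.pos.ne' hi))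
        linarith
      have h5 : ((1 / (2 * r)) ^ 2 - (i : ℝ) ^ 2) = -(4 * (r * i : ℝ) ^ 2 - 1) / (4 * r ^ 2) := by
        field_simp
        ring
      have h6 : (-1 : ℝ) ^ (r * i + 1) = -(-1) ^ i := by
        rw [pow_succ, pow_mul, hr.neg_one_pow]; ring
      rw [h5, h6]
      push_cast
      field_simp
  · simp only [pow_zero, Nat.cast_zero, mul_zero, cos_zero]
    field_simp
    ring

theorem cosCoeff_mul_nonpos {r : ℕ} (hr : Even r) (i : ℕ) : cosCoeff (r * i) ≤ 0 := by
  rw [cosCoeff]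
  split_ifs with h
  · rfl
  · have hj : (1 : ℝ) ≤ ((r * i : ℕ) : ℝ) ^ 2 := by
      exact_mod_cast Nat.one_le_pow _ _ (Nat.one_le_iff_ne_zero.mpr h)
    rw [((hr.mul_right i).add_one).neg_one_pow]
    refine mul_nonpos_of_nonneg_of_nonpos (by positivity) ?_
    exact div_nonpos_of_nonpos_of_nonneg (by norm_num) (by linarith)

end FunctionFieldMean

end

noncomputable section

namespace FunctionFieldMean
open Real Set

/-! ### The sums `∑ cos (2πky) / k` -/

theorem log_le_sum_inv (K : ℕ) : log (K + 1) ≤ ∑ k ∈ Finset.Icc 1 K, (1 : ℝ) / k := by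
  have := log_add_one_le_harmonic K
  rw [harmonic_eq_sum_Icc] at this
  push_cast at this
  simpa using this

theorem sum_inv_le_log (K : ℕ) : ∑ k ∈ Finset.Icc 1 K, (1 : ℝ) / k ≤ 1 + log K := by
  have := harmonic_le_one_add_log K
  rw [harmonic_eq_sum_Icc] at this
  push_cast at this
  simpa using this

theorem sum_cos_div_le (K : ℕ) (y : ℝ) :
    ∑ k ∈ Finset.Icc 1 K, cos (2 * π * k * y) / k ≤ 1 + log K := by
  refine le_trans (Finset.sum_le_sum fun k _ => ?_) (sum_inv_le_log K)
  gcongr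
  exact cos_le_one _

/-- Termwise, from cos x ≥ 1 - x for x ≥ 0. -/
theorem le_sum_cos_div (K : ℕ) {y : ℝ} (hy : 0 ≤ y) :
    log (K + 1) - 2 * π * (K * y) ≤ ∑ k ∈ Finset.Icc 1 K, cos (2 * π * k * y) / k := by
  have h : ∑ k ∈ Finset.Icc 1 K, ((1 : ℝ) / k - 2 * π * y) ≤
      ∑ k ∈ Finset.Icc 1 K, cos (2 * π * k * y) / k := by
    refine Finset.sum_le_sum fun k hk => ?_
    have hk0 : (0 : ℝ) < k := by exact_mod_cast (Finset.mem_Icc.mp hk).1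
    rw [le_div_iff₀ hk0, sub_mul, one_div_mul_cancel hk0.ne']
    have hx : 0 ≤ 2 * π * k * y := by positivity
    have h1 : 2 * π * k * y = 2 * π * y * k := by ring
    rcases le_total (2 * π * k * y) 2 with h2 | h2
    · have := one_sub_sq_div_two_le_cos (x := 2 * π * k * y)
      nlinarith
    · have := neg_one_le_cos (2 * π * k * y)
      rcases le_total (cos (2 * π * k * y)) (-1) with h3 | h3 <;> linarith
  refine le_trans ?_ h
  rw [Finset.sum_sub_distrib, Finset.sum_const, Nat.card_Icc, nsmul_eq_mul]
  have := log_le_sum_inv K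
  push_cast
  linarith

/-- Summation by parts: 2 sin(πy) cos(2πky) telescopes as s(k+1) - s(k), and sin(πy) ≥ 2y on [0,
1/2]. -/
theorem abs_sum_cos_div_tail_le {a b : ℕ} (ha : 1 ≤ a) (hab : a ≤ b) {y : ℝ} (hy : 0 < y)
    (hy' : y ≤ 1 / 2) : |∑ k ∈ Finset.Ico a b, cos (2 * π * k * y) / k| ≤ 1 / (2 * a * y) := by
  set s : ℕ → ℝ := fun k => sin (π * (2 * k - 1) * y) with hs
  have ha0 : (0 : ℝ) < a := by exact_mod_cast ha
  -- Keeping the boundary term inside the absolute value lets the induction close.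
  have hmain : ∀ b, a ≤ b → |∑ k ∈ Finset.Ico a b, (s (k + 1) - s k) / k - s b / b| ≤
      2 / a - 1 / b := by
    intro b hb
    induction b, hb using Nat.le_induction with
    | base =>
      simp only [Finset.Ico_self, Finset.sum_empty, zero_sub, abs_neg]
      rw [abs_div, abs_of_pos ha0, ← sub_div]
      gcongr
      have := abs_sin_le_one (π * (2 * a - 1) * y)
      simp only [hs]; linarith
    | succ b hb ih =>
      have hb0 : (0 : ℝ) < b := by exact_mod_cast (lt_of_lt_of_le ha hb)
      rw [Finset.sum_Ico_succ_top hb]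
      have e1 : ∑ k ∈ Finset.Ico a b, (s (k + 1) - s k) / k + (s (b + 1) - s b) / b -
          s (b + 1) / ((b + 1 : ℕ) : ℝ) =
          (∑ k ∈ Finset.Ico a b, (s (k + 1) - s k) / k - s b / b) +
            s (b + 1) * (1 / b - 1 / ((b + 1 : ℕ) : ℝ)) := by ring
      rw [e1]
      refine (abs_add_le _ _).trans ?_
      have h1 : 0 ≤ 1 / (b : ℝ) - 1 / ((b + 1 : ℕ) : ℝ) := by
        rw [sub_nonneg]
        apply one_div_le_one_div_of_le hb0
        push_cast; linarith
      rw [abs_mul, abs_of_nonneg h1]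
      have h2 : |s (b + 1)| ≤ 1 := abs_sin_le_one _
      nlinarith
  have hsin : 2 * y ≤ sin (π * y) := by
    have := mul_le_sin (x := π * y) (by positivity) (by nlinarith [pi_pos])
    rwa [← mul_assoc, div_mul_cancel₀ _ pi_ne_zero] at this
  have hsum : ∑ k ∈ Finset.Ico a b, (s (k + 1) - s k) / k =
      2 * sin (π * y) * ∑ k ∈ Finset.Ico a b, cos (2 * π * k * y) / k := by
    rw [Finset.mul_sum]
    refine Finset.sum_congr rfl fun k _ => ?_
    have : s (k + 1) - s k = 2 * sin (π * y) * cos (2 * π * k * y) := by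
      simp only [hs]
      rw [sin_sub_sin]
      push_cast
      ring_nf
    rw [this, mul_div_assoc]
  have h1 : |∑ k ∈ Finset.Ico a b, (s (k + 1) - s k) / k| ≤ 2 / a := by
    have h2 := hmain b hab
    have hb0 : (0 : ℝ) < b := by exact_mod_cast (lt_of_lt_of_le ha hab)
    have h3 : |s b / b| ≤ 1 / b := by
      rw [abs_div, abs_of_pos hb0]
      gcongr
      exact abs_sin_le_one _
    have h4 := abs_add_le (∑ k ∈ Finset.Ico a b, (s (k + 1) - s k) / k - s b / b) (s b / b)
    rw [sub_add_cancel] at h4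
    linarith
  rw [hsum, abs_mul, abs_of_pos (by linarith)] at h1
  rw [le_div_iff₀ (by positivity)]
  rw [le_div_iff₀ ha0] at h1
  nlinarith [abs_nonneg (∑ k ∈ Finset.Ico a b, cos (2 * π * k * y) / k), mul_le_mul_of_nonneg_left
    hsin (mul_nonneg (abs_nonneg (∑ k ∈ Finset.Ico a b, cos (2 * π * k * y) / k)) ha0.le)]

/-- `∑_{k < n} cos (2πky) / k` is `log (min (n, 1 / ‖y‖))` up to a bounded error. -/
theorem abs_sum_cos_div_add_log_le {n : ℕ} (hn : 1 ≤ n) {y : ℝ} (hy : 0 ≤ y) (hy' : y ≤ 1 / 2) :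
    |∑ k ∈ Finset.Ico 1 n, cos (2 * π * k * y) / k + log (max (1 / n) y)| ≤ 9 := by
  have hn0 : (0 : ℝ) < n := by exact_mod_cast hn
  have hpi := pi_lt_d2
  have hpi0 := pi_pos
  rcases le_or_gt y (1 / n) with h | h
  · rw [max_eq_left h, one_div, log_inv]
    obtain ⟨K, rfl⟩ : ∃ K, n = K + 1 := ⟨n - 1, by omega⟩
    have hI : Finset.Ico 1 (K + 1) = Finset.Icc 1 K := by ext; simp
    rw [hI]
    have h1 := sum_cos_div_le K y
    have h2 := le_sum_cos_div K hy
    have h3 : log K ≤ log (K + 1) := by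
      rcases Nat.eq_zero_or_pos K with rfl | hK
      · simp
      · exact log_le_log (by exact_mod_cast hK) (by linarith)
    have h4 : K * y ≤ 1 := by
      push_cast at h hn0
      rw [le_div_iff₀ hn0] at h
      nlinarith
    push_cast
    rw [abs_le]
    constructor <;> nlinarith
  · have hy0 : 0 < y := lt_trans (by positivity) h
    rw [max_eq_right h.le]
    -- Up to 1/y the terms behave like 1/k and give -log y; beyond it the tail oscillates and is
    -- bounded.
    set K := ⌊1 / y⌋₊ with hK
    have hK1 : (K : ℝ) ≤ 1 / y := Nat.floor_le (by positivity)
    have hK2 : 1 / y < K + 1 := Nat.lt_floor_add_one _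
    have hK3 : K < n := by
      have : (K : ℝ) < n := lt_of_le_of_lt hK1 (by rwa [div_lt_comm₀ hy0 hn0])
      exact_mod_cast this
    have hK4 : 1 ≤ K := by
      rw [hK, Nat.one_le_floor_iff, le_div_iff₀ hy0]; linarith
    have hI : Finset.Ico 1 (K + 1) = Finset.Icc 1 K := by ext; simp
    rw [← Finset.sum_Ico_consecutive _ (by omega : 1 ≤ K + 1) (by omega : K + 1 ≤ n), hI]
    have h1 := sum_cos_div_le K y
    have h2 := le_sum_cos_div K hy
    have h3 := abs_sum_cos_div_tail_le (by omega : 1 ≤ K + 1) (by omega : K + 1 ≤ n) hy0 hy'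
    have h4 : 1 / (2 * ((K + 1 : ℕ) : ℝ) * y) ≤ 1 := by
      push_cast
      rw [div_lt_iff₀ hy0] at hK2
      rw [div_le_one (by positivity)]
      linarith
    have h5 : log K ≤ -log y := by
      rw [← log_inv, ← one_div]
      exact log_le_log (by exact_mod_cast hK4) hK1
    have h6 : -log y ≤ log (K + 1) := by
      rw [← log_inv, ← one_div]
      exact log_le_log (by positivity) hK2.le
    have h7 : K * y ≤ 1 := by rwa [le_div_iff₀ hy0] at hK1
    have h8 := abs_le.mp (h3.trans h4)
    rw [abs_le]
    constructor <;> nlinarith [h8.1, h8.2]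

theorem cos_two_pi_mul_round (k : ℕ) (y : ℝ) :
    cos (2 * π * k * |y - round y|) = cos (2 * π * k * y) := by
  have : cos (2 * π * k * |y - round y|) = cos (2 * π * k * (y - round y)) := by
    rw [← cos_abs (2 * π * k * (y - round y)), abs_mul, abs_of_nonneg (by positivity : 0 ≤ 2 * π * k)]
  rw [this, show 2 * π * k * (y - round y) = 2 * π * k * y - ((k * round y : ℤ) : ℝ) * (2 * π) by
    push_cast; ring, cos_sub_int_mul_two_pi]

theorem abs_sum_cos_div_add_log_round_le {n : ℕ} (hn : 1 ≤ n) (y : ℝ) :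
    |∑ k ∈ Finset.Ico 1 n, cos (2 * π * k * y) / k + log (max (1 / n) |y - round y|)| ≤ 9 := by
  have := abs_sum_cos_div_add_log_le hn (abs_nonneg (y - round y)) (abs_sub_round y)
  simpa only [cos_two_pi_mul_round] using this

end FunctionFieldMean

end

noncomputable section

namespace FunctionFieldMean
open Real Set

/-! ### Bounds for `∑ |cos (πkα)| / k` -/

theorem hasSum_sum_abs_cos (n : ℕ) (α : ℝ) :
    HasSum (fun j : ℕ => cosCoeff j * ∑ k ∈ Finset.Ico 1 n, cos (2 * π * k * (j * α)) / k)
      (∑ k ∈ Finset.Ico 1 n, |cos (π * (k * α))| / k - 2 / π * ∑ k ∈ Finset.Ico 1 n, 1 / (k : ℝ)) := by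
  have h := hasSum_sum (s := Finset.Ico 1 n) fun k _ => (hasSum_abs_cos (k * α)).mul_right (1 / (k : ℝ))
  convert! h using 1
  · ext j
    rw [Finset.mul_sum]
    refine Finset.sum_congr rfl fun k _ => ?_
    rw [show 2 * π * k * (j * α) = 2 * π * j * (k * α) by ring]
    ring
  · rw [Finset.mul_sum, ← Finset.sum_sub_distrib]
    refine Finset.sum_congr rfl fun k _ => ?_
    ring

/-- jb/r is not an integer, so it lies at least 1/r from any integer; the perturbation jβ costs at
most 1/(2r), and what remains is 1/(2r) ≥ 1/(4J). -/
theorem le_abs_sub_round_of_not_dvd {r j J : ℕ} (hr : 0 < r) {b : ℤ} {α β : ℝ}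
    (hb : IsCoprime b (r : ℤ)) (hα : α = b / r + β) (hrJ : r ≤ 2 * J) (hβ : |β| ≤ 1 / ((2 * J + 1) * r))
    (hj : j ≤ J) (hrj : ¬ r ∣ j) : 1 / (4 * J : ℝ) ≤ |j * α - round (j * α)| := by
  set z := round (j * α)
  have hr0 : (0 : ℝ) < r := by exact_mod_cast hr
  have hrJ' : (r : ℝ) ≤ 2 * J := by exact_mod_cast hrJ
  have hj' : (j : ℝ) ≤ J := by exact_mod_cast hj
  have hne : (j : ℤ) * b - z * r ≠ 0 := by
    intro h
    have h1 : (r : ℤ) ∣ j * b := ⟨z, by linarith⟩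
    exact hrj (by exact_mod_cast hb.symm.dvd_of_dvd_mul_right h1)
  have h1 : (1 : ℝ) ≤ |(j : ℝ) * b - z * r| := by
    exact_mod_cast Int.one_le_abs hne
  have h2 : j * α - z = (j * b - z * r) / r + j * β := by rw [hα]; field_simp; ring
  have h3 : 1 / r ≤ |((j : ℝ) * b - z * r) / r| := by
    rw [abs_div, abs_of_pos hr0]; gcongr
  have h4 : |j * β| ≤ 1 / (2 * r) := by
    rw [abs_mul, abs_of_nonneg (Nat.cast_nonneg j)]
    calc (j : ℝ) * |β| ≤ J * (1 / ((2 * J + 1) * r)) := by gcongr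
      _ ≤ 1 / (2 * r) := by
        rw [mul_one_div, div_le_div_iff₀ (by positivity) (by positivity)]
        nlinarith
  have h5 : |((j : ℝ) * b - z * r) / r| ≤ |j * α - z| + |j * β| := by
    have := abs_sub (j * α - z) (j * β)
    rw [h2] at this ⊢
    rwa [add_sub_cancel_right] at this
  have h6 : 1 / (4 * J : ℝ) ≤ 1 / (2 * r) := by
    apply one_div_le_one_div_of_le (by positivity); linarith
  have h7 : (1 : ℝ) / r = 1 / (2 * r) + 1 / (2 * r) := by field_simp; ring
  linarith

/-- Here jα differs from jβ by an integer, and |jβ| < 1/2. -/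
theorem abs_sub_round_of_dvd {r j J : ℕ} (hr : 0 < r) {b : ℤ} {α β : ℝ}
    (hα : α = b / r + β) (hβ : |β| ≤ 1 / ((2 * J + 1) * r))
    (hj : j ≤ J) (hrj : r ∣ j) : |j * α - round (j * α)| = j * |β| := by
  obtain ⟨i, rfl⟩ := hrj
  have hr0 : (1 : ℝ) ≤ r := by exact_mod_cast hr
  have hj' : ((r * i : ℕ) : ℝ) ≤ J := by exact_mod_cast hj
  have h1 : ((r * i : ℕ) : ℝ) * α = ((i * b : ℤ) : ℝ) + (r * i : ℕ) * β := by
    rw [hα]; push_cast; field_simp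
  have h2 : |((r * i : ℕ) : ℝ) * β| < 1 / 2 := by
    rw [abs_mul, abs_of_nonneg (Nat.cast_nonneg _)]
    calc ((r * i : ℕ) : ℝ) * |β| ≤ J * (1 / ((2 * J + 1) * r)) := by gcongr
      _ < 1 / 2 := by
        rw [mul_one_div, div_lt_div_iff₀ (by positivity) (by positivity)]
        nlinarith [Nat.cast_nonneg (α := ℝ) J]
  have h3 : round (((r * i : ℕ) : ℝ) * β) = 0 := by
    rw [round_eq_zero_iff]
    exact ⟨by linarith [(abs_lt.mp h2).1], (abs_lt.mp h2).2⟩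
  rw [h1, round_intCast_add, h3]
  push_cast
  rw [show (i * b + r * i * β - (i * b + 0) : ℝ) = r * i * β by ring, abs_mul,
    abs_of_nonneg (by positivity : (0 : ℝ) ≤ r * i)]

theorem abs_log_max_sub_le {x y u t : ℝ} (hx : 0 < x) (hyu : y ≤ u) (ht : 1 ≤ t)
    (hu : u ≤ t * y) : |log (max x u) - log (max x y)| ≤ log t := by
  have h1 : 0 < max x y := lt_max_of_lt_left hx
  have h2 : max x y ≤ max x u := max_le_max le_rfl hyu
  have h3 : max x u ≤ t * max x y := by
    refine max_le ?_ (hu.trans ?_)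
    · nlinarith [le_max_left x y]
    · gcongr; exact le_max_right _ _
  have h4 := log_le_log h1 h2
  have h5 := log_le_log (h1.trans_le h2) h3
  rw [log_mul (by positivity) h1.ne'] at h5
  rw [abs_of_nonneg] <;> linarith

theorem log_le_two_mul_sqrt {x : ℝ} (hx : 1 ≤ x) : log x ≤ 2 * √x := by
  have h : 0 < √x := sqrt_pos.mpr (by linarith)
  have h1 := log_le_sub_one_of_pos h
  rw [log_sqrt (by linarith)] at h1
  linarith

/-- The exponential sums over `k < n` at the multiples of `α`, when `α` is close to `b / r`. -/
theorem abs_sum_cos_sub_le {n r j J : ℕ} (hn : 1 ≤ n) (hr : 0 < r) {b : ℤ} {α β : ℝ}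
    (hb : IsCoprime b (r : ℤ)) (hα : α = b / r + β) (hrJ : r ≤ 2 * J)
    (hβ : |β| ≤ 1 / ((2 * J + 1) * r)) (hJ : (1 + log n) ^ 2 ≤ J) (hj : 1 ≤ j) :
    |∑ k ∈ Finset.Ico 1 n, cos (2 * π * k * (j * α)) / k +
      (if r ∣ j then log (max (1 / n) (r * |β|)) else 0)| ≤
      11 * √j + (if r = 1 then 0 else log (4 * J)) := by
  have hn0 : (1 : ℝ) ≤ n := by exact_mod_cast hn
  have hlogn : 0 ≤ log n := log_nonneg hn0
  have hJ0 : (1 : ℝ) ≤ J := by nlinarith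
  have hr0 : (1 : ℝ) ≤ r := by exact_mod_cast hr
  have hj0 : (1 : ℝ) ≤ j := by exact_mod_cast hj
  have hsj : 1 ≤ √j := one_le_sqrt.mpr hj0
  have hE : 0 ≤ (if r = 1 then 0 else log (4 * J : ℝ)) := by
    split_ifs
    · rfl
    · exact log_nonneg (by linarith)
  have hrβ : r * |β| ≤ 1 := by
    calc r * |β| ≤ r * (1 / ((2 * J + 1) * r)) := by gcongr
      _ ≤ 1 := by
        rw [mul_one_div, div_le_one (by positivity)]
        nlinarith
  have hlog : ∀ t : ℝ, t ≤ 1 → log (max (1 / n) t) ≤ 0 ∧ -log n ≤ log (max (1 / n) t) := by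
    intro t ht
    have h0 : (0 : ℝ) < 1 / n := by positivity
    constructor
    · apply log_nonpos (h0.le.trans (le_max_left _ _))
      exact max_le (by rw [div_le_one] <;> linarith) ht
    · rw [← log_inv, ← one_div]
      exact log_le_log h0 (le_max_left _ _)
  have hT := abs_sum_cos_div_add_log_round_le hn (j * α)
  -- For j > J all logarithms are at most log n, which is below √j by the choice of J.
  rcases lt_or_ge J j with hJj | hJj
  · have h1 := hlog (|j * α - round (j * α)|) ((abs_sub_round _).trans (by norm_num))
    have h2 := hlog _ hrβ
    have h3 : 1 + log n ≤ √j := by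
      apply le_sqrt_of_sq_le
      have : (J : ℝ) ≤ j := by exact_mod_cast hJj.le
      linarith
    have hT' := abs_le.mp hT
    refine le_trans ?_ (le_add_of_nonneg_right hE)
    rw [abs_le]
    split_ifs <;> constructor <;> linarith [hT'.1, hT'.2, h1.1, h1.2, h2.1, h2.2]
  · by_cases hrj : r ∣ j
    · rw [if_pos hrj]
      rw [abs_sub_round_of_dvd hr hα hβ hJj hrj] at hT
      have hrj' : (r : ℝ) ≤ j := by exact_mod_cast Nat.le_of_dvd hj hrj
      -- Replacing j|β| by r|β| makes the main term independent of j, at a cost of log j ≤ 2√j;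
      -- hence 11 = 9 + 2.
      have h1 := abs_log_max_sub_le (x := 1 / n) (y := r * |β|) (u := j * |β|) (t := j)
        (by positivity) (by gcongr) hj0
        (by nlinarith [mul_nonneg (by linarith : (0 : ℝ) ≤ j) (abs_nonneg β)])
      have h2 := log_le_two_mul_sqrt hj0
      have hT' := abs_le.mp hT
      have h1' := abs_le.mp h1
      refine le_trans ?_ (le_add_of_nonneg_right hE)
      rw [abs_le]
      constructor <;> linarith [hT'.1, hT'.2, h1'.1, h1'.2]
    · have hr1 : r ≠ 1 := fun h => hrj (h ▸ one_dvd j)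
      rw [if_neg hrj, if_neg hr1, add_zero]
      have h1 := le_abs_sub_round_of_not_dvd hr hb hα hrJ hβ hJj hrj
      have h2 := hlog (|j * α - round (j * α)|) ((abs_sub_round _).trans (by norm_num))
      have h3 : -log (4 * J) ≤ log (max (1 / n) |j * α - round (j * α)|) := by
        rw [← log_inv, ← one_div]
        exact log_le_log (by positivity) (h1.trans (le_max_right _ _))
      have hT' := abs_le.mp hT
      rw [abs_le]
      constructor <;> linarith [hT'.1, hT'.2, h2.1, h2.2]

theorem summable_sqrt_div_sq : Summable fun j : ℕ => √j / (j : ℝ) ^ 2 := by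
  have h := Real.summable_one_div_nat_rpow.mpr (by norm_num : (1 : ℝ) < 3 / 2)
  refine h.congr fun j => ?_
  rcases Nat.eq_zero_or_pos j with rfl | hj
  · simp
  · have hj0 : (0 : ℝ) < j := by exact_mod_cast hj
    rw [sqrt_eq_rpow, ← rpow_natCast, ← rpow_sub hj0, one_div, ← rpow_neg hj0.le]
    norm_num

/-- The estimates of `abs_sum_cos_sub_le` are summed against the Fourier coefficients, which are
O(1/j²), so errors of size √j are harmless. Multiples of r add up to d times one logarithm.
Non-multiples cost log(4J); for r = 1 there are none, and the absence of this loss is what keeps the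
main term of the theorem free of extra logarithms. -/
theorem exists_sum_abs_cos_le : ∃ C : ℝ, 0 ≤ C ∧ ∀ (n r J : ℕ) (b : ℤ) (α β d : ℝ), 1 ≤ n → 0 < r →
    IsCoprime b (r : ℤ) → α = b / r + β → r ≤ 2 * J → |β| ≤ 1 / ((2 * J + 1) * r) →
    (1 + log n) ^ 2 ≤ J → HasSum (fun i : ℕ => cosCoeff (r * i)) d →
    ∑ k ∈ Finset.Ico 1 n, |cos (π * (k * α))| / k ≤
      2 / π * log n - d * log (max (1 / n) (r * |β|)) + C +
        (if r = 1 then 0 else C * log (4 * J)) := by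
  have hs2 : Summable fun j : ℕ => 1 / (j : ℝ) ^ 2 := Real.summable_one_div_nat_pow.mpr (by norm_num)
  set Z1 := ∑' j : ℕ, √j / (j : ℝ) ^ 2
  set Z2 := ∑' j : ℕ, 1 / (j : ℝ) ^ 2
  have hZ1 : 0 ≤ Z1 := tsum_nonneg fun j => by positivity
  have hZ2 : 0 ≤ Z2 := tsum_nonneg fun j => by positivity
  refine ⟨1 + 11 * Z1 + Z2, by positivity, ?_⟩
  intro n r J b α β d hn hr hb hα hrJ hβ hJ hd
  set lam := log (max (1 / n) (r * |β|))
  set E : ℝ := if r = 1 then 0 else log (4 * J) with hE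
  have hn0 : (1 : ℝ) ≤ n := by exact_mod_cast hn
  have hlogn : 0 ≤ log n := log_nonneg hn0
  have hJ0 : (1 : ℝ) ≤ J := by nlinarith
  have hE0 : 0 ≤ E := by
    rw [hE]
    split_ifs
    · rfl
    · exact log_nonneg (by linarith)
  have h1 := hasSum_sum_abs_cos n α
  have h2 : HasSum (fun j : ℕ => cosCoeff j * (if r ∣ j then lam else 0)) (d * lam) := by
    have hinj : Function.Injective fun i : ℕ => r * i := fun i i' h => Nat.eq_of_mul_eq_mul_left hr h
    rw [← hinj.hasSum_iff]
    · convert! hd.mul_right lam using 1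
      ext i
      simp
    · intro j hj
      rw [if_neg, mul_zero]
      rintro ⟨i, rfl⟩
      exact hj ⟨i, rfl⟩
  have h3 := h1.add h2
  have h4 : HasSum (fun j : ℕ => 11 * (√j / (j : ℝ) ^ 2) + E * (1 / (j : ℝ) ^ 2)) (11 * Z1 + E * Z2) :=
    (summable_sqrt_div_sq.hasSum.mul_left 11).add (hs2.hasSum.mul_left E)
  have h5 := hasSum_le (fun j => ?_) h3 h4
  · have h6 : ∑ k ∈ Finset.Ico 1 n, 1 / (k : ℝ) ≤ 1 + log n := by
      refine le_trans ?_ (sum_inv_le_log n)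
      apply Finset.sum_le_sum_of_subset_of_nonneg
      · intro k; simp; omega
      · intros; positivity
    have h7 : 2 / π * ∑ k ∈ Finset.Ico 1 n, 1 / (k : ℝ) ≤ 2 / π * (1 + log n) := by gcongr
    have h8 : 2 / π ≤ 1 := by rw [div_le_one pi_pos]; linarith [pi_gt_three]
    have h9 : E * Z2 ≤ (if r = 1 then 0 else (1 + 11 * Z1 + Z2) * log (4 * J)) := by
      rw [hE]
      split_ifs
      · simp
      · rw [mul_comm]
        apply mul_le_mul_of_nonneg_right _ (log_nonneg (by linarith))
        linarith
    linarith
  · rcases Nat.eq_zero_or_pos j with rfl | hj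
    · simp [cosCoeff]
    · rw [← mul_add]
      refine (le_abs_self _).trans ?_
      rw [abs_mul]
      calc _ ≤ 1 / (j : ℝ) ^ 2 * (11 * √j + E) := by
            apply mul_le_mul (abs_cosCoeff_le j) _ (abs_nonneg _) (by positivity)
            exact abs_sum_cos_sub_le hn hr hb hα hrJ hβ hJ hj
        _ = _ := by ring

end FunctionFieldMean

end

noncomputable section

namespace FunctionFieldMean
open Real Set

/-! ### The constants `c_m` -/

theorem mul_sin_pos {m : ℕ} (hm : 1 ≤ m) : 0 < m * sin (π / (2 * m)) := by
  have hm0 : (1 : ℝ) ≤ m := by exact_mod_cast hm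
  refine mul_pos (by linarith) (sin_pos_of_pos_of_lt_pi (by positivity) ?_)
  exact div_lt_self pi_pos (by linarith)

theorem two_div_pi_le_c {m : ℕ} (hm : 1 ≤ m) : 2 / π ≤ c m := by
  have hm0 : (1 : ℝ) ≤ m := by exact_mod_cast hm
  have h := sin_le (x := π / (2 * m)) (by positivity)
  rw [c, div_le_div_iff₀ pi_pos (mul_sin_pos hm)]
  calc 2 * (m * sin (π / (2 * m))) ≤ 2 * (m * (π / (2 * m))) := by gcongr
    _ = 1 * π := by field_simp

/-- By concavity of sin on [0, π] and sin 0 = 0, m sin(π/(2m)) increases with m. -/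
theorem c_anti {m r : ℕ} (hm : 1 ≤ m) (hmr : m ≤ r) : c r ≤ c m := by
  have hm0 : (1 : ℝ) ≤ m := by exact_mod_cast hm
  have hr0 : (m : ℝ) ≤ r := by exact_mod_cast hmr
  have hr1 : (0 : ℝ) < r := by linarith
  refine one_div_le_one_div_of_le (mul_sin_pos hm) ?_
  have h1 : π / (2 * m) ≤ π := div_le_self pi_pos.le (by linarith)
  have h := strictConcaveOn_sin_Icc.concaveOn.2 (⟨le_rfl, pi_pos.le⟩ : (0 : ℝ) ∈ Icc 0 π)
    (⟨by positivity, h1⟩ : π / (2 * m) ∈ Icc 0 π)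
    (by rw [sub_nonneg, div_le_one hr1]; exact hr0 : (0 : ℝ) ≤ 1 - m / r)
    (by positivity : (0 : ℝ) ≤ m / r) (by ring)
  have h2 : (m / r : ℝ) * (π / (2 * m)) = π / (2 * r) := by field_simp
  simp only [smul_eq_mul, mul_zero, sin_zero, zero_add, h2] at h
  calc m * sin (π / (2 * m)) = r * (m / r * sin (π / (2 * m))) := by field_simp
    _ ≤ r * sin (π / (2 * r)) := by gcongr

theorem c_one : c 1 = 1 := by simp [c]

theorem c_three : c 3 = 2 / 3 := by
  rw [c, show π / (2 * (3 : ℕ)) = π / 6 by push_cast; ring, sin_pi_div_six]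
  norm_num

/-! ### The supremum of `(1 - z ^ l) G(z)` on the unit circle -/

theorem e_add (s t : ℝ) : e (s + t) = e s * e t := by
  rw [e, e, e, ← Complex.exp_add]; push_cast; ring_nf

theorem norm_e (t : ℝ) : ‖e t‖ = 1 := by
  rw [e, show (2 * π * Complex.I * t : ℂ) = (2 * π * t : ℝ) * Complex.I by push_cast; ring,
    Complex.norm_exp_ofReal_mul_I]

theorem e_int (z : ℤ) : e z = 1 := by
  rw [e, show (2 * π * Complex.I * (z : ℝ) : ℂ) = z * (2 * π * Complex.I) by push_cast; ring,
    Complex.exp_int_mul_two_pi_mul_I]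

theorem norm_one_sub_e_le (t : ℝ) : ‖1 - e t‖ ≤ 2 * π * |t| := by
  rw [norm_sub_rev, e, show (2 * π * Complex.I * t : ℂ) = Complex.I * (2 * π * t : ℝ) by
    push_cast; ring]
  refine norm_exp_I_mul_ofReal_sub_one_le.trans ?_
  rw [norm_mul, norm_of_nonneg (by positivity : 0 ≤ 2 * π), norm_eq_abs]

theorem norm_one_sub_e_le_two (t : ℝ) : ‖1 - e t‖ ≤ 2 := by
  refine (norm_sub_le _ _).trans ?_
  rw [norm_e, norm_one]; norm_num

/-- The zero of 1 - e(lβ) at β = 0 compensates the growth of g^x: for g ≤ l the trivial bound 2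
suffices, and for g ≥ l one has |β| ≤ 1/g and g^(x-1) ≤ l^(x-1). -/
theorem norm_one_sub_e_mul_rpow_le {l : ℕ} (hl : 1 ≤ l) {β g x : ℝ} (hg : 0 < g) (hβ : |β| * g ≤ 1)
    (hx : 0 ≤ x) (hx' : x ≤ 1) : ‖1 - e (l * β)‖ * g ^ x ≤ 2 * π * (l : ℝ) ^ x := by
  have hl0 : (1 : ℝ) ≤ l := by exact_mod_cast hl
  have hl1 : (0 : ℝ) < l := by linarith
  rcases le_total g l with h | h
  · calc ‖1 - e (l * β)‖ * g ^ x ≤ 2 * (l : ℝ) ^ x := by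
          gcongr; exact norm_one_sub_e_le_two _
      _ ≤ 2 * π * (l : ℝ) ^ x := by
          gcongr; linarith [pi_gt_three]
  · have h1 : |β| ≤ 1 / g := by rwa [le_div_iff₀ hg]
    calc ‖1 - e (l * β)‖ * g ^ x ≤ 2 * π * |l * β| * g ^ x := by
          gcongr; exact norm_one_sub_e_le _
      _ ≤ 2 * π * (l * (1 / g)) * g ^ x := by
          rw [abs_mul, abs_of_pos hl1]; gcongr
      _ = 2 * π * (l * g ^ (x - 1)) := by
          rw [rpow_sub_one hg.ne']; ring
      _ ≤ 2 * π * (l * (l : ℝ) ^ (x - 1)) := by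
          gcongr 2 * π * (l * ?_)
          exact rpow_le_rpow_of_nonpos hl1 h (by linarith)
      _ = 2 * π * (l : ℝ) ^ x := by
          rw [rpow_sub_one hl1.ne']; field_simp

theorem hasSum_cosCoeff_even {r : ℕ} (hr : Even r) (hr0 : 0 < r) :
    ∃ d ≤ 0, HasSum (fun i : ℕ => cosCoeff (r * i)) d := by
  have hs2 : Summable fun j : ℕ => 1 / (j : ℝ) ^ 2 := Real.summable_one_div_nat_pow.mpr (by norm_num)
  have h : Summable fun i : ℕ => cosCoeff (r * i) := by
    refine Summable.of_norm_bounded hs2 fun i => ?_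
    refine (abs_cosCoeff_le _).trans ?_
    rcases Nat.eq_zero_or_pos i with rfl | hi
    · simp
    · have hi0 : (0 : ℝ) < i := by exact_mod_cast hi
      have : (i : ℝ) ≤ (r * i : ℕ) := by exact_mod_cast Nat.le_mul_of_pos_left i hr0
      gcongr
  exact ⟨_, tsum_nonpos fun i => cosCoeff_mul_nonpos hr i, h.hasSum⟩

/-- A power of P (later 1 + log n) is absorbed either by l^(1/3), when l ≥ P^(3p), or by a larger
power of P, when l is smaller. -/
theorem rpow_mul_rpow_le_add {l P p : ℝ} (hl : 1 ≤ l) (hP : 1 ≤ P) (hp : 0 ≤ p) {x : ℝ}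
    (hx : 0 ≤ x) (hx' : x ≤ 1) :
    l ^ x * P ^ p ≤ l ^ (x + 1 / 3) + P ^ (4 * p) := by
  have hP0 : 0 < P := by linarith
  have hl0 : 0 < l := by linarith
  rcases le_total (P ^ (3 * p)) l with h | h
  · refine le_trans ?_ (le_add_of_nonneg_right (by positivity))
    rw [rpow_add hl0]
    gcongr
    calc P ^ p = (P ^ (3 * p)) ^ (1 / 3 : ℝ) := by rw [← rpow_mul hP0.le]; congr 1; ring
      _ ≤ l ^ (1 / 3 : ℝ) := by gcongr
  · refine le_trans ?_ (le_add_of_nonneg_left (by positivity))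
    calc l ^ x * P ^ p ≤ (P ^ (3 * p)) ^ x * P ^ p := by gcongr
      _ ≤ (P ^ (3 * p)) ^ (1 : ℝ) * P ^ p := by
        gcongr
        exact one_le_rpow hP (by positivity)
      _ = P ^ (4 * p) := by rw [rpow_one, ← rpow_add hP0]; congr 1; ring

theorem norm_one_sub_e_eq_of_dvd {l r : ℕ} (hr : 0 < r) (h : r ∣ l) {b : ℤ} {α β : ℝ}
    (hα : α = b / r + β) : e (l * α) = e (l * β) := by
  obtain ⟨i, rfl⟩ := h
  have hr0 : (r : ℝ) ≠ 0 := by exact_mod_cast hr.ne'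
  have : ((r * i : ℕ) : ℝ) * α = ((i * b : ℤ) : ℝ) + (r * i : ℕ) * β := by
    rw [hα]; push_cast; field_simp
  rw [this, e_add, e_int, one_mul]

theorem exists_norm_one_sub_mul_exp_le : ∃ C B : ℝ, 0 ≤ C ∧ 0 ≤ B ∧ ∀ (n l m : ℕ) (α : ℝ),
    1 ≤ n → 1 ≤ l → IsLeast {k : ℕ | Odd k ∧ ¬ k ∣ l} m →
    ‖1 - e (l * α)‖ * exp (∑ k ∈ Finset.Ico 1 n, |cos (π * (k * α))| / k) ≤
      C * ((n : ℝ) ^ (2 / π) * (l : ℝ) ^ (1 - 2 / π) + (n : ℝ) ^ c m * (1 + log n) ^ B) := by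
  obtain ⟨C₁, hC₁, hS⟩ := exists_sum_abs_cos_le
  -- The loss (4J)^C₁ with J about (1 + log n)² is a power p = 2C₁ of 1 + log n; the further factor
  -- 4 comes from `rpow_mul_rpow_le_add`.
  refine ⟨exp C₁ * (2 * π) * 8 ^ C₁, 4 * (2 * C₁), by positivity, by positivity, ?_⟩
  intro n l m α hn hl hm
  set p := 2 * C₁ with hp
  have hp0 : 0 ≤ p := by positivity
  have hn0 : (1 : ℝ) ≤ n := by exact_mod_cast hn
  have hl0 : (1 : ℝ) ≤ l := by exact_mod_cast hl
  have hlogn : 0 ≤ log n := log_nonneg hn0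
  set P := 1 + log n with hP
  have hP1 : 1 ≤ P := by linarith
  set J := ⌈P ^ 2⌉₊ with hJ
  have hJ1 : P ^ 2 ≤ J := Nat.le_ceil _
  have hJ2 : (J : ℝ) < P ^ 2 + 1 := Nat.ceil_lt_add_one (by positivity)
  have hJ0 : 0 < J := Nat.ceil_pos.mpr (by positivity)
  have hJ0' : (1 : ℝ) ≤ J := by exact_mod_cast hJ0
  have hm1 : 3 ≤ m := by
    rcases hm.1 with ⟨⟨t, rfl⟩, hd⟩
    rcases Nat.eq_zero_or_pos t with rfl | ht
    · simp at hd
    · omega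
  have hx0 : 0 ≤ 2 / 3 - 2 / π := by
    rw [sub_nonneg, div_le_div_iff₀ pi_pos (by norm_num)]
    linarith [pi_gt_three]
  have hpi2 : 0 < 2 / π := by positivity
  have h2pi : 2 ≤ 2 * π := by linarith [pi_gt_three]
  -- Dirichlet's approximation theorem with denominator at most 2J.
  obtain ⟨q, hq1, hq2⟩ := Real.exists_rat_abs_sub_le_and_den_le α (by omega : 0 < 2 * J)
  set r := q.den
  set b := q.num
  set β := α - q with hβ
  have hr : 0 < r := q.den_pos
  have hr0 : (1 : ℝ) ≤ r := by exact_mod_cast hr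
  have hα : α = b / r + β := by
    rw [hβ, Rat.cast_def q]; ring
  have hcop : IsCoprime b (r : ℤ) := by
    rw [Int.isCoprime_iff_nat_coprime]
    simpa using q.reduced
  have hβ1 : |β| ≤ 1 / ((2 * J + 1) * r) := by exact_mod_cast hq1
  have hrβ : r * |β| ≤ 1 := by
    calc r * |β| ≤ r * (1 / ((2 * J + 1) * r)) := by gcongr
      _ ≤ 1 := by
        rw [mul_one_div, div_le_one (by positivity)]
        nlinarith
  -- Since g = 1/w, g stands for min(n, 1/(r|β|)).
  set w : ℝ := max (1 / n) (r * |β|) with hw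
  have hw0 : 0 < w := lt_max_of_lt_left (by positivity)
  set g := 1 / w with hg
  have hg0 : 0 < g := by positivity
  have hg1 : 1 ≤ g := by
    rw [hg, le_div_iff₀ hw0, one_mul]
    exact max_le (by rw [div_le_one] <;> linarith) hrβ
  have hgn : g ≤ n := by
    rw [hg, div_le_comm₀ hw0 (by linarith)]
    exact le_max_left _ _
  have hβg : |β| * g ≤ 1 := by
    rw [hg, mul_one_div, div_le_one hw0]
    exact le_trans (by nlinarith [abs_nonneg β]) (le_max_right _ _)
  have hJpow : (4 * J : ℝ) ^ C₁ ≤ 8 ^ C₁ * P ^ p := by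
    calc (4 * J : ℝ) ^ C₁ ≤ (8 * P ^ (2 : ℝ)) ^ C₁ := by
          refine rpow_le_rpow (by positivity) ?_ hC₁
          rw [rpow_two]
          nlinarith
      _ = 8 ^ C₁ * P ^ p := by
          rw [mul_rpow (by norm_num) (by positivity), ← rpow_mul (by positivity), hp]
  have h8 : (1 : ℝ) ≤ 8 ^ C₁ := one_le_rpow (by norm_num) hC₁
  have hexp : ∀ d : ℝ, HasSum (fun i : ℕ => cosCoeff (r * i)) d →
      exp (∑ k ∈ Finset.Ico 1 n, |cos (π * (k * α))| / k) ≤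
        exp C₁ * 8 ^ C₁ * ((n : ℝ) ^ (2 / π) * g ^ d * (if r = 1 then 1 else P ^ p)) := by
    intro d hd
    refine (exp_le_exp.mpr (hS n r J b α β d hn hr hcop hα hq2 hβ1 hJ1 hd)).trans ?_
    have e1 : exp (2 / π * log n) = (n : ℝ) ^ (2 / π) := by
      rw [rpow_def_of_pos (by linarith), mul_comm]
    have e2 : exp (-(d * log w)) = g ^ d := by
      rw [rpow_def_of_pos hg0, hg, one_div, log_inv]; congr 1; ring
    have e3 : exp (if r = 1 then 0 else C₁ * log (4 * J)) ≤
        8 ^ C₁ * (if r = 1 then 1 else P ^ p) := by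
      split_ifs
      · simpa using h8
      · rwa [mul_comm, ← rpow_def_of_pos (by positivity)]
    rw [exp_add, exp_add, sub_eq_add_neg, exp_add, e1, e2]
    calc _ ≤ (n : ℝ) ^ (2 / π) * g ^ d * exp C₁ * (8 ^ C₁ * (if r = 1 then 1 else P ^ p)) := by
          gcongr
      _ = _ := by ring
  have hPp : ∀ s : ℝ, 0 ≤ s → 1 ≤ P ^ s := fun s hs => one_le_rpow hP1 hs
  have hcm : (n : ℝ) ^ (2 / π) ≤ (n : ℝ) ^ c m :=
    rpow_le_rpow_of_exponent_le hn0 (two_div_pi_le_c (by omega))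
  have hif : (if r = 1 then 1 else P ^ p) ≤ P ^ (4 * p) := by
    split_ifs
    · exact hPp _ (by positivity)
    · exact rpow_le_rpow_of_exponent_le hP1 (by linarith)
  set X := exp C₁ * 8 ^ C₁ with hX
  have hX0 : 0 ≤ X := by positivity
  -- For even r and for r ≥ m, the trivial bound |1 - e(lα)| ≤ 2 is enough.
  have hfin : ∀ d : ℝ, HasSum (fun i : ℕ => cosCoeff (r * i)) d →
      (n : ℝ) ^ (2 / π) * g ^ d ≤ (n : ℝ) ^ c m →
      ‖1 - e (l * α)‖ * exp (∑ k ∈ Finset.Ico 1 n, |cos (π * (k * α))| / k) ≤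
      exp C₁ * (2 * π) * 8 ^ C₁ * ((n : ℝ) ^ (2 / π) * (l : ℝ) ^ (1 - 2 / π) +
        (n : ℝ) ^ c m * P ^ (4 * p)) := by
    intro d hd h
    calc _ ≤ 2 * (X * ((n : ℝ) ^ (2 / π) * g ^ d * (if r = 1 then 1 else P ^ p))) := by
          gcongr
          · exact norm_one_sub_e_le_two _
          · exact hexp d hd
      _ ≤ 2 * π * (X * ((n : ℝ) ^ c m * P ^ (4 * p))) := by gcongr
      _ = exp C₁ * (2 * π) * 8 ^ C₁ * ((n : ℝ) ^ c m * P ^ (4 * p)) := by rw [hX]; ring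
      _ ≤ _ := by
          gcongr
          exact le_add_of_nonneg_left (by positivity)
  rcases Nat.even_or_odd r with hre | hro
  · obtain ⟨d, hd0, hd⟩ := hasSum_cosCoeff_even hre hr
    refine hfin d hd ?_
    calc (n : ℝ) ^ (2 / π) * g ^ d ≤ (n : ℝ) ^ (2 / π) * 1 := by
          gcongr
          exact rpow_le_one_of_one_le_of_nonpos hg1 hd0
      _ ≤ _ := by rwa [mul_one]
  · have hd := hasSum_cosCoeff_mul hro
    rcases le_or_gt m r with hmr | hmr
    · refine hfin _ hd ?_
      calc (n : ℝ) ^ (2 / π) * g ^ (c r - 2 / π) ≤ (n : ℝ) ^ (2 / π) * (n : ℝ) ^ (c r - 2 / π) := by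
            gcongr
            exact sub_nonneg.mpr (two_div_pi_le_c hr)
        _ = (n : ℝ) ^ c r := by rw [← rpow_add (by linarith)]; congr 1; ring
        _ ≤ _ := rpow_le_rpow_of_exponent_le hn0 (c_anti (by omega) hmr)
    · have hdvd : r ∣ l := by
        by_contra h
        exact absurd (hm.2 ⟨hro, h⟩) (by omega)
      rw [norm_one_sub_e_eq_of_dvd hr hdvd hα]
      by_cases hr1 : r = 1
      · have hE := hexp _ hd
        rw [if_pos hr1, hr1, c_one, mul_one] at hE
        have h1 := norm_one_sub_e_mul_rpow_le hl hg0 hβg (x := 1 - 2 / π) (by linarith) (by linarith)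
        calc _ ≤ ‖1 - e (l * β)‖ * (X * ((n : ℝ) ^ (2 / π) * g ^ (1 - 2 / π))) := by gcongr
          _ = X * (n : ℝ) ^ (2 / π) * (‖1 - e (l * β)‖ * g ^ (1 - 2 / π)) := by ring
          _ ≤ X * (n : ℝ) ^ (2 / π) * (2 * π * (l : ℝ) ^ (1 - 2 / π)) := by gcongr
          _ = exp C₁ * (2 * π) * 8 ^ C₁ * ((n : ℝ) ^ (2 / π) * (l : ℝ) ^ (1 - 2 / π)) := by
            rw [hX]; ring
          _ ≤ _ := by
            gcongr
            exact le_add_of_nonneg_right (by positivity)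
      · have hr3 : 3 ≤ r := by
          rcases hro with ⟨t, ht⟩
          omega
        have hE := hexp _ hd
        rw [if_neg hr1] at hE
        -- As c_r ≤ c_3 = 2/3, a factor l^(1/3) is left over compared with r = 1, and it pays for
        -- the powers of log n.
        have hc3 : c r - 2 / π ≤ 2 / 3 - 2 / π := by
          have := c_anti (by norm_num) hr3
          rw [c_three] at this
          linarith
        have h1 := norm_one_sub_e_mul_rpow_le hl hg0 hβg hx0 (by linarith)
        have h2 := rpow_mul_rpow_le_add hl0 hP1 hp0 hx0 (by linarith)
        rw [show (2 / 3 - 2 / π + 1 / 3 : ℝ) = 1 - 2 / π by ring] at h2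
        calc _ ≤ ‖1 - e (l * β)‖ * (X * ((n : ℝ) ^ (2 / π) * g ^ (2 / 3 - 2 / π) * P ^ p)) := by
              refine mul_le_mul_of_nonneg_left (hE.trans ?_) (norm_nonneg _)
              gcongr
          _ = X * (n : ℝ) ^ (2 / π) * P ^ p * (‖1 - e (l * β)‖ * g ^ (2 / 3 - 2 / π)) := by ring
          _ ≤ X * (n : ℝ) ^ (2 / π) * P ^ p * (2 * π * (l : ℝ) ^ (2 / 3 - 2 / π)) := by gcongr
          _ = X * (2 * π) * (n : ℝ) ^ (2 / π) * ((l : ℝ) ^ (2 / 3 - 2 / π) * P ^ p) := by ring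
          _ ≤ X * (2 * π) * (n : ℝ) ^ (2 / π) * ((l : ℝ) ^ (1 - 2 / π) + P ^ (4 * p)) := by gcongr
          _ = exp C₁ * (2 * π) * 8 ^ C₁ * ((n : ℝ) ^ (2 / π) * (l : ℝ) ^ (1 - 2 / π) +
                (n : ℝ) ^ (2 / π) * P ^ (4 * p)) := by rw [hX]; ring
          _ ≤ _ := by gcongr

end FunctionFieldMean

end

noncomputable section

namespace FunctionFieldMean
open Real

/-! ### Power series `exp (∑ χ(k) z ^ k / k)` -/

/-- The power series `φ` converges absolutely at `z`, with sum `w`. -/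
def AbsConverges (φ : PowerSeries ℂ) (z w : ℂ) : Prop :=
  Summable (fun j => ‖PowerSeries.coeff j φ * z ^ j‖) ∧ ∑' j, PowerSeries.coeff j φ * z ^ j = w

theorem AbsConverges.mul {φ ψ : PowerSeries ℂ} {z u v : ℂ} (h1 : AbsConverges φ z u)
    (h2 : AbsConverges ψ z v) : AbsConverges (φ * ψ) z (u * v) := by
  set f : ℕ → ℂ := fun j => PowerSeries.coeff j φ * z ^ j with hf
  set g : ℕ → ℂ := fun j => PowerSeries.coeff j ψ * z ^ j with hg
  have hf1 : Summable fun j => ‖f j‖ := h1.1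
  have hg1 : Summable fun j => ‖g j‖ := h2.1
  have key : (fun j => PowerSeries.coeff j (φ * ψ) * z ^ j) =
      fun j => ∑ p ∈ Finset.HasAntidiagonal.antidiagonal j, f p.1 * g p.2 := by
    funext j
    rw [PowerSeries.coeff_mul, Finset.sum_mul]
    refine Finset.sum_congr rfl fun p hp => ?_
    rw [← Finset.HasAntidiagonal.mem_antidiagonal.mp hp, pow_add]
    simp only [hf, hg]
    ring
  refine ⟨?_, ?_⟩
  · have := summable_norm_sum_mul_antidiagonal_of_summable_norm hf1 hg1
    exact this.congr fun j => congrArg norm (congrFun key j).symm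
  · have := tsum_mul_tsum_eq_tsum_sum_antidiagonal_of_summable_norm hf1 hg1
    rw [← key] at this
    rw [← this]
    exact congrArg₂ _ h1.2 h2.2

theorem AbsConverges.one (z : ℂ) : AbsConverges 1 z 1 := by
  have h : HasSum (fun j => PowerSeries.coeff j (1 : PowerSeries ℂ) * z ^ j) 1 := by
    have := hasSum_single (f := fun j => PowerSeries.coeff j (1 : PowerSeries ℂ) * z ^ j) 0
      (fun j hj => by simp [PowerSeries.coeff_one, hj])
    simpa using this
  exact ⟨h.summable.norm, h.tsum_eq⟩

theorem AbsConverges.sub {φ ψ : PowerSeries ℂ} {z u v : ℂ} (h1 : AbsConverges φ z u)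
    (h2 : AbsConverges ψ z v) : AbsConverges (φ - ψ) z (u - v) := by
  have key : ∀ j, PowerSeries.coeff j (φ - ψ) * z ^ j =
      PowerSeries.coeff j φ * z ^ j - PowerSeries.coeff j ψ * z ^ j := by
    intro j; rw [map_sub, sub_mul]
  have h := h1.1.of_norm.hasSum.sub h2.1.of_norm.hasSum
  rw [h1.2, h2.2] at h
  simp_rw [← key] at h
  exact ⟨h.summable.norm, h.tsum_eq⟩

theorem AbsConverges.X_pow (z : ℂ) (l : ℕ) : AbsConverges (PowerSeries.X ^ l) z (z ^ l) := by
  have h : HasSum (fun j => PowerSeries.coeff j (PowerSeries.X ^ l : PowerSeries ℂ) * z ^ j)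
      (z ^ l) := by
    have := hasSum_single (f := fun j => PowerSeries.coeff j (PowerSeries.X ^ l : PowerSeries ℂ) * z ^ j) l
      (fun j hj => by simp [PowerSeries.coeff_X_pow, hj])
    simpa [PowerSeries.coeff_X_pow] using this
  exact ⟨h.summable.norm, h.tsum_eq⟩

/-- The power series `exp (a z ^ k / k)`. -/
def expMonomial (a : ℂ) (k : ℕ) : PowerSeries ℂ :=
  PowerSeries.mk fun j => if k ∣ j then (a / k) ^ (j / k) / (j / k).factorial else 0

theorem absConverges_expMonomial (a z : ℂ) {k : ℕ} (hk : 0 < k) :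
    AbsConverges (expMonomial a k) z (Complex.exp (a * z ^ k / k)) := by
  have hinj : Function.Injective fun i : ℕ => k * i := fun i i' h => Nat.eq_of_mul_eq_mul_left hk h
  have h0 : HasSum (fun i : ℕ => (a * z ^ k / k) ^ i / (i.factorial : ℂ))
      (Complex.exp (a * z ^ k / k)) := by
    rw [Complex.exp_eq_exp_ℂ]
    exact NormedSpace.expSeries_div_hasSum_exp (a * z ^ k / k)
  have h : HasSum (fun j => PowerSeries.coeff j (expMonomial a k) * z ^ j)
      (Complex.exp (a * z ^ k / k)) := by
    rw [← hinj.hasSum_iff]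
    · convert! h0 using 1
      ext i
      simp only [Function.comp, expMonomial, PowerSeries.coeff_mk, dvd_mul_right, if_true,
        Nat.mul_div_cancel_left i hk]
      rw [pow_mul, mul_div_right_comm a, mul_pow]
      ring
    · intro j hj
      rw [expMonomial, PowerSeries.coeff_mk, if_neg, zero_mul]
      rintro ⟨i, rfl⟩
      exact hj ⟨i, rfl⟩
  exact ⟨h.summable.norm, h.tsum_eq⟩

theorem X_mul_derivative_expMonomial (a : ℂ) {k : ℕ} (hk : 0 < k) :
    PowerSeries.X * PowerSeries.derivative ℂ (expMonomial a k) =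
      PowerSeries.C a * PowerSeries.X ^ k * expMonomial a k := by
  ext j
  rw [mul_assoc, PowerSeries.coeff_C_mul, PowerSeries.coeff_X_pow_mul']
  have hL : PowerSeries.coeff j (PowerSeries.X * PowerSeries.derivative ℂ (expMonomial a k)) =
      j * PowerSeries.coeff j (expMonomial a k) := by
    rcases j with _ | j
    · simp
    · rw [PowerSeries.coeff_succ_X_mul, PowerSeries.coeff_derivative]; push_cast; ring
  rw [hL]
  simp only [expMonomial, PowerSeries.coeff_mk]
  have hk0 : (k : ℂ) ≠ 0 := by exact_mod_cast hk.ne'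
  by_cases hj : k ∣ j
  · obtain ⟨i, rfl⟩ := hj
    rcases i with _ | i
    · simp [hk.ne']
    · have h1 : k * (i + 1) - k = k * i := by rw [mul_add, mul_one, Nat.add_sub_cancel]
      rw [if_pos (dvd_mul_right _ _), if_pos (Nat.le_mul_of_pos_right _ (Nat.succ_pos i)), h1,
        if_pos (dvd_mul_right _ _), Nat.mul_div_cancel_left _ hk, Nat.mul_div_cancel_left _ hk,
        Nat.factorial_succ]
      have h2 : ((i : ℂ) + 1) ≠ 0 := by exact_mod_cast Nat.succ_ne_zero i
      have h3 : (i.factorial : ℂ) ≠ 0 := by exact_mod_cast Nat.factorial_ne_zero i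
      push_cast
      rw [pow_succ]
      field_simp
  · rw [if_neg hj, mul_zero]
    split_ifs with h1 h2
    · exact absurd ((Nat.dvd_sub_iff_left h1 dvd_rfl).mp h2) hj
    · simp
    · simp

/-- The power series `exp (∑_{k < n} χ(k) z ^ k / k)`. -/
def expSeries (χ : ℕ → ℂ) (n : ℕ) : PowerSeries ℂ := ∏ k ∈ Finset.Ico 1 n, expMonomial (χ k) k

theorem absConverges_expSeries (χ : ℕ → ℂ) (n : ℕ) (z : ℂ) :
    AbsConverges (expSeries χ n) z (Complex.exp (∑ k ∈ Finset.Ico 1 n, χ k * z ^ k / k)) := by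
  rw [expSeries, Complex.exp_sum]
  have : ∀ s : Finset ℕ, (∀ k ∈ s, 0 < k) → AbsConverges (∏ k ∈ s, expMonomial (χ k) k) z
      (∏ k ∈ s, Complex.exp (χ k * z ^ k / k)) := by
    intro s
    induction s using Finset.induction_on with
    | empty => intro _; simpa using AbsConverges.one z
    | insert a s ha ih =>
      intro h
      rw [Finset.prod_insert ha, Finset.prod_insert ha]
      exact (absConverges_expMonomial _ _ (h a (Finset.mem_insert_self a s))).mul
        (ih fun k hk => h k (Finset.mem_insert_of_mem hk))
  exact this _ fun k hk => (Finset.mem_Ico.mp hk).1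

/-- Logarithmic derivatives of the factors add up. Reading off coefficients yields the recursion. -/
theorem X_mul_derivative_expSeries (χ : ℕ → ℂ) (n : ℕ) :
    PowerSeries.X * PowerSeries.derivative ℂ (expSeries χ n) =
      (∑ k ∈ Finset.Ico 1 n, PowerSeries.C (χ k) * PowerSeries.X ^ k) * expSeries χ n := by
  have : ∀ s : Finset ℕ, (∀ k ∈ s, 0 < k) →
      PowerSeries.X * PowerSeries.derivative ℂ (∏ k ∈ s, expMonomial (χ k) k) =
      (∑ k ∈ s, PowerSeries.C (χ k) * PowerSeries.X ^ k) * ∏ k ∈ s, expMonomial (χ k) k := by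
    intro s
    induction s using Finset.induction_on with
    | empty => intro _; simp
    | insert a s ha ih =>
      intro h
      rw [Finset.prod_insert ha, Finset.sum_insert ha, Derivation.leibniz, smul_eq_mul, smul_eq_mul]
      linear_combination expMonomial (χ a) a * (ih fun k hk => h k (Finset.mem_insert_of_mem hk)) +
        (∏ k ∈ s, expMonomial (χ k) k) *
          X_mul_derivative_expMonomial (χ a) (h a (Finset.mem_insert_self a s))
  exact this _ fun k hk => (Finset.mem_Ico.mp hk).1

theorem coeff_X_mul_derivative (φ : PowerSeries ℂ) (j : ℕ) :
    PowerSeries.coeff j (PowerSeries.X * PowerSeries.derivative ℂ φ) =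
      j * PowerSeries.coeff j φ := by
  rcases j with _ | j
  · simp
  · rw [PowerSeries.coeff_succ_X_mul, PowerSeries.coeff_derivative]; push_cast; ring

theorem coeff_sum_mul (χ : ℕ → ℂ) (s : Finset ℕ) (φ : PowerSeries ℂ) (j : ℕ) :
    PowerSeries.coeff j ((∑ k ∈ s, PowerSeries.C (χ k) * PowerSeries.X ^ k) * φ) =
      ∑ k ∈ s, χ k * (if k ≤ j then PowerSeries.coeff (j - k) φ else 0) := by
  rw [Finset.sum_mul, map_sum]
  refine Finset.sum_congr rfl fun k _ => ?_
  rw [mul_assoc, PowerSeries.coeff_C_mul, PowerSeries.coeff_X_pow_mul']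

theorem coeff_expSeries_zero (χ : ℕ → ℂ) (n : ℕ) :
    PowerSeries.coeff 0 (expSeries χ n) = 1 := by
  rw [PowerSeries.coeff_zero_eq_constantCoeff_apply, expSeries, map_prod]
  refine Finset.prod_eq_one fun k _ => ?_
  rw [← PowerSeries.coeff_zero_eq_constantCoeff_apply, expMonomial, PowerSeries.coeff_mk]
  simp

theorem coeff_expSeries_rec (χ : ℕ → ℂ) (n j : ℕ) :
    j * PowerSeries.coeff j (expSeries χ n) =
      ∑ k ∈ Finset.Icc 1 j, (if k < n then χ k else 0) * PowerSeries.coeff (j - k) (expSeries χ n) := by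
  rw [← coeff_X_mul_derivative, X_mul_derivative_expSeries, coeff_sum_mul]
  simp_rw [mul_ite, mul_zero, ite_mul, zero_mul]
  rw [← Finset.sum_filter, ← Finset.sum_filter]
  refine Finset.sum_congr ?_ fun _ _ => rfl
  ext k; simp; omega

/-! ### Sequences with `n σ(n) = ∑ χ(k) σ(n - k)` -/

/-- `σ` is the sequence of coefficients of `exp (∑ χ(k) z ^ k / k)`. -/
def IsExpSeq (χ σ : ℕ → ℂ) : Prop :=
  σ 0 = 1 ∧ ∀ j : ℕ, j * σ j = ∑ k ∈ Finset.Icc 1 j, χ k * σ (j - k)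

theorem isExpSeq_expSeries (χ : ℕ → ℂ) (n : ℕ) :
    IsExpSeq (fun k => if k < n then χ k else 0) (fun j => PowerSeries.coeff j (expSeries χ n)) :=
  ⟨coeff_expSeries_zero χ n, coeff_expSeries_rec χ n⟩

/-- By induction, j σ(j) is a sum of j products of norm at most 1. -/
theorem IsExpSeq.norm_le_one {χ σ : ℕ → ℂ} (h : IsExpSeq χ σ) (hχ : ∀ k, ‖χ k‖ ≤ 1) (j : ℕ) :
    ‖σ j‖ ≤ 1 := by
  induction j using Nat.strong_induction_on with
  | _ j ih =>
    rcases Nat.eq_zero_or_pos j with rfl | hj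
    · rw [h.1, norm_one]
    · have hj0 : (0 : ℝ) < j := by exact_mod_cast hj
      have h1 : ‖(j : ℂ) * σ j‖ ≤ ∑ k ∈ Finset.Icc 1 j, (1 : ℝ) := by
        rw [h.2]
        refine norm_sum_le_of_le _ fun k hk => ?_
        rw [Finset.mem_Icc] at hk
        rw [norm_mul]
        exact mul_le_one₀ (hχ k) (norm_nonneg _) (ih _ (by omega))
      rw [norm_mul, Complex.norm_natCast, Finset.sum_const, Nat.card_Icc, nsmul_eq_mul, mul_one,
        Nat.add_sub_cancel] at h1
      exact le_of_mul_le_mul_left (by linarith) hj0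

theorem IsExpSeq.unique {χ ψ σ τ : ℕ → ℂ} (h1 : IsExpSeq χ σ) (h2 : IsExpSeq ψ τ) {n : ℕ}
    (hχ : ∀ k, 1 ≤ k → k < n → χ k = ψ k) (j : ℕ) (hj : j < n) : σ j = τ j := by
  induction j using Nat.strong_induction_on with
  | _ j ih =>
    rcases Nat.eq_zero_or_pos j with rfl | hj'
    · rw [h1.1, h2.1]
    · have hj0 : (j : ℂ) ≠ 0 := by exact_mod_cast hj'.ne'
      apply mul_left_cancel₀ hj0
      rw [h1.2, h2.2]
      refine Finset.sum_congr rfl fun k hk => ?_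
      rw [Finset.mem_Icc] at hk
      rw [hχ k hk.1 (by omega), ih (j - k) (by omega) (by omega)]

/-- Truncating `χ` at `n` changes `σ` very little just after `n`. -/
theorem IsExpSeq.norm_sub_le {χ σ τ : ℕ → ℂ} {n : ℕ} (hn : 1 ≤ n) (h1 : IsExpSeq χ σ)
    (h2 : IsExpSeq (fun k => if k < n then χ k else 0) τ) (hχ : ∀ k, ‖χ k‖ ≤ 1) (l : ℕ) :
    ‖σ (n + l) - τ (n + l)‖ ≤ (3 * l + 1) / n := by
  set ψ : ℕ → ℂ := fun k => if k < n then χ k else 0 with hψ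
  have hψ1 : ∀ k, ‖ψ k‖ ≤ 1 := by
    intro k
    simp only [hψ]
    split_ifs
    · exact hχ k
    · simp
  have hs := h1.norm_le_one hχ
  have ht := h2.norm_le_one hψ1
  have hn0 : (0 : ℝ) < n := by exact_mod_cast hn
  have hd : ∀ j, j < n → σ j = τ j := h1.unique h2 fun k _ hk => by simp [hψ, hk]
  have hrec : ((n + l : ℕ) : ℂ) * (σ (n + l) - τ (n + l)) =
      ∑ k ∈ Finset.Icc 1 (n + l), (ψ k * (σ (n + l - k) - τ (n + l - k)) +
        (χ k - ψ k) * σ (n + l - k)) := by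
    rw [mul_sub, h1.2, h2.2, ← Finset.sum_sub_distrib]
    exact Finset.sum_congr rfl fun k _ => by ring
  -- Below n the two sequences agree, so the first part needs k ≤ l (at most l terms of size 2); the
  -- second needs k ≥ n (at most l + 1 terms of size 1). Hence 3l + 1.
  have hbd : ∀ k ∈ Finset.Icc 1 (n + l), ‖ψ k * (σ (n + l - k) - τ (n + l - k)) +
        (χ k - ψ k) * σ (n + l - k)‖ ≤ (if k ≤ l then 2 else 0) + (if n ≤ k then 1 else 0) := by
    intro k hk
    rw [Finset.mem_Icc] at hk
    refine (norm_add_le _ _).trans (add_le_add ?_ ?_)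
    · split_ifs with hkl
      · rw [norm_mul]
        have := _root_.norm_sub_le (σ (n + l - k)) (τ (n + l - k))
        have h3 := mul_le_mul (hψ1 k) this (norm_nonneg _) zero_le_one
        linarith [hs (n + l - k), ht (n + l - k)]
      · rw [hd _ (by omega)]; simp
    · simp only [hψ]
      split_ifs with h3 h4 h4
      · omega
      · simp
      · rw [sub_zero, norm_mul]
        exact mul_le_one₀ (hχ k) (norm_nonneg _) (hs _)
      · omega
  have h3 := norm_sum_le_of_le _ hbd
  rw [← hrec, norm_mul, Complex.norm_natCast, Finset.sum_add_distrib, ← Finset.sum_filter,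
    ← Finset.sum_filter, Finset.sum_const, Finset.sum_const] at h3
  have c1 : (Finset.filter (fun k => k ≤ l) (Finset.Icc 1 (n + l))).card ≤ l := by
    have : Finset.filter (fun k => k ≤ l) (Finset.Icc 1 (n + l)) ⊆ Finset.Icc 1 l := by
      intro k; simp; omega
    simpa using Finset.card_le_card this
  have c2 : (Finset.filter (fun k => n ≤ k) (Finset.Icc 1 (n + l))).card ≤ l + 1 := by
    have : Finset.filter (fun k => n ≤ k) (Finset.Icc 1 (n + l)) ⊆ Finset.Icc n (n + l) := by
      intro k; simp; omega
    refine (Finset.card_le_card this).trans ?_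
    simp; omega
  have c1' : ((Finset.filter (fun k => k ≤ l) (Finset.Icc 1 (n + l))).card : ℝ) ≤ l := by
    exact_mod_cast c1
  have c2' : ((Finset.filter (fun k => n ≤ k) (Finset.Icc 1 (n + l))).card : ℝ) ≤ l + 1 := by
    exact_mod_cast c2
  rw [nsmul_eq_mul, nsmul_eq_mul] at h3
  rw [le_div_iff₀ hn0]
  push_cast at h3
  nlinarith [norm_nonneg (σ (n + l) - τ (n + l)), mul_nonneg (Nat.cast_nonneg (α := ℝ) l)
    (norm_nonneg (σ (n + l) - τ (n + l)))]

end FunctionFieldMean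

end

noncomputable section

namespace FunctionFieldMean
open Real

/-! ### Toeplitz forms -/

@[fun_prop]
theorem continuous_e : Continuous e := by
  unfold e; fun_prop

theorem e_zero : e 0 = 1 := by simp [e]

theorem e_mul_nat (k : ℕ) (t : ℝ) : e (k * t) = e t ^ k := by
  rw [e, e, ← Complex.exp_nat_mul]; congr 1; push_cast; ring

theorem star_e (t : ℝ) : (starRingEnd ℂ) (e t) = e (-t) := by
  rw [e, e, ← Complex.exp_conj]
  congr 1
  simp only [map_mul, Complex.conj_ofReal, Complex.conj_I, map_ofNat]
  push_cast
  ring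

theorem integral_e (s : ℤ) : ∫ α in (0 : ℝ)..1, e (s * α) = if s = 0 then 1 else 0 := by
  split_ifs with h
  · simp [h, e_zero]
  · have hs : (2 * π * Complex.I * s : ℂ) ≠ 0 := by
      have : (π : ℂ) ≠ 0 := by exact_mod_cast pi_ne_zero
      have : (s : ℂ) ≠ 0 := by exact_mod_cast h
      simp [*, Complex.I_ne_zero]
    have : ∀ α : ℝ, e (s * α) = Complex.exp ((2 * π * Complex.I * s) * α) := by
      intro α; rw [e]; congr 1; push_cast; ring
    simp_rw [this]
    rw [integral_exp_mul_complex hs]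
    have h1 : Complex.exp (2 * π * Complex.I * s * (1 : ℝ)) = 1 := by
      rw [show (2 * π * Complex.I * s * (1 : ℝ) : ℂ) = s * (2 * π * Complex.I) by push_cast; ring,
        Complex.exp_int_mul_two_pi_mul_I]
    rw [h1]
    simp

/-- Parseval's identity. The sign ε allows frequencies -j as well as j, both of which occur in the
Toeplitz form. -/
theorem integral_norm_sq_sum_e {ε : ℤ} (hε : ε ≠ 0) (s : Finset ℕ) (w : ℕ → ℂ) :
    ∫ α in (0 : ℝ)..1, ‖∑ j ∈ s, w j * e ((ε * j : ℤ) * α)‖ ^ 2 = ∑ j ∈ s, ‖w j‖ ^ 2 := by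
  have h : ∫ α in (0 : ℝ)..1, ((‖∑ j ∈ s, w j * e ((ε * j : ℤ) * α)‖ ^ 2 : ℝ) : ℂ) =
      ∑ j ∈ s, ((‖w j‖ ^ 2 : ℝ) : ℂ) := by
    have e1 : ∀ α : ℝ, ((‖∑ j ∈ s, w j * e ((ε * j : ℤ) * α)‖ ^ 2 : ℝ) : ℂ) =
        ∑ j ∈ s, ∑ i ∈ s, w j * (starRingEnd ℂ) (w i) * e ((ε * j - ε * i : ℤ) * α) := by
      intro α
      push_cast
      rw [← Complex.mul_conj', map_sum, Finset.sum_mul_sum]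
      refine Finset.sum_congr rfl fun j _ => Finset.sum_congr rfl fun i _ => ?_
      rw [map_mul, star_e, show ((ε * j - ε * i : ℝ) * α) = ε * j * α + -(ε * i * α) by ring, e_add]
      ring
    simp_rw [e1]
    rw [intervalIntegral.integral_finsetSum
      (fun j _ => Continuous.intervalIntegrable (by fun_prop) _ _)]
    refine Finset.sum_congr rfl fun j hj => ?_
    rw [intervalIntegral.integral_finsetSum
      (fun j _ => Continuous.intervalIntegrable (by fun_prop) _ _)]
    simp_rw [intervalIntegral.integral_const_mul, integral_e]
    rw [Finset.sum_eq_single_of_mem j hj]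
    · rw [sub_self, if_pos rfl, mul_one, Complex.mul_conj']
      push_cast; rfl
    · intro i _ hij
      rw [if_neg, mul_zero]
      rw [← mul_sub]
      refine mul_ne_zero hε (sub_ne_zero.mpr ?_)
      exact_mod_cast hij.symm
  rw [intervalIntegral.integral_ofReal] at h
  exact_mod_cast h

theorem continuous_tsum_e {h : ℕ → ℂ} (hh : Summable fun k => ‖h k‖) :
    Continuous fun α : ℝ => ∑' k : ℕ, h k * e (k * α) := by
  refine continuous_tsum (fun k => by fun_prop) hh fun k α => ?_
  rw [norm_mul, norm_e, mul_one]

theorem integral_e_mul_tsum {h : ℕ → ℂ} (hh : Summable fun k => ‖h k‖) (j b : ℕ) :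
    ∫ α in (0 : ℝ)..1, e ((b - j : ℤ) * α) * ∑' k : ℕ, h k * e (k * α) =
      if b ≤ j then h (j - b) else 0 := by
  set f : ℕ → C(ℝ, ℂ) := fun k => ⟨fun α => e ((b - j : ℤ) * α) * (h k * e (k * α)), by fun_prop⟩
  have hf : ∀ k α, f k α = h k * e ((b - j + k : ℤ) * α) := by
    intro k α
    change e ((b - j : ℤ) * α) * (h k * e (k * α)) = _
    rw [show ((b - j + k : ℤ) : ℝ) * α = (b - j : ℤ) * α + k * α by push_cast; ring, e_add]
    ring
  have hsum : Summable fun k => ‖(f k).restrict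
      (⟨Set.uIcc (0 : ℝ) 1, isCompact_uIcc⟩ : TopologicalSpace.Compacts ℝ)‖ := by
    refine Summable.of_nonneg_of_le (fun _ => norm_nonneg _) (fun k => ?_) hh
    refine (ContinuousMap.norm_le _ (norm_nonneg _)).mpr fun x => ?_
    rw [ContinuousMap.restrict_apply, hf, norm_mul, norm_e, mul_one]
  have h1 := intervalIntegral.hasSum_intervalIntegral_of_summable_norm hsum
  have h2 : ∀ α : ℝ, ∑' k, f k α = e ((b - j : ℤ) * α) * ∑' k : ℕ, h k * e (k * α) := by
    intro α
    rw [← tsum_mul_left]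
    rfl
  simp_rw [h2, hf, intervalIntegral.integral_const_mul, integral_e] at h1
  rw [← h1.tsum_eq]
  split_ifs with hbj
  · rw [tsum_eq_single (j - b)]
    · rw [if_pos, mul_one]; omega
    · intro k hk
      rw [if_neg, mul_zero]; omega
  · refine (tsum_congr fun k => ?_).trans tsum_zero
    rw [if_neg, mul_zero]; omega

/-- A bilinear form with Toeplitz matrix `h(j - b)` is bounded by the supremum of its symbol. -/
theorem norm_toeplitz_le {h : ℕ → ℂ} (hh : Summable fun k => ‖h k‖) {M : ℝ}
    (hM : ∀ α : ℝ, ‖∑' k : ℕ, h k * e (k * α)‖ ≤ M) (A B : Finset ℕ) (w v : ℕ → ℂ) {t : ℝ}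
    (ht : 0 < t) :
    ‖∑ j ∈ A, ∑ b ∈ B, w j * (v b * if b ≤ j then h (j - b) else 0)‖ ≤
      M / 2 * (t * ∑ j ∈ A, ‖w j‖ ^ 2 + t⁻¹ * ∑ b ∈ B, ‖v b‖ ^ 2) := by
  set H : ℝ → ℂ := fun α => ∑' k : ℕ, h k * e (k * α) with hH
  have hHc : Continuous H := continuous_tsum_e hh
  set W : ℝ → ℂ := fun α => ∑ j ∈ A, w j * e ((-1 * j : ℤ) * α) with hW
  set V : ℝ → ℂ := fun α => ∑ b ∈ B, v b * e ((1 * b : ℤ) * α) with hV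
  have hWc : Continuous W := by fun_prop
  have hVc : Continuous V := by fun_prop
  -- The matrix entry is a Fourier coefficient of the symbol H, so the form is the integral of W V
  -- H.
  have key : ∑ j ∈ A, ∑ b ∈ B, w j * (v b * if b ≤ j then h (j - b) else 0) =
      ∫ α in (0 : ℝ)..1, W α * V α * H α := by
    have e1 : ∀ α, W α * V α * H α =
        ∑ j ∈ A, ∑ b ∈ B, w j * (v b * (e ((b - j : ℤ) * α) * H α)) := by
      intro α
      rw [hW, hV, Finset.sum_mul_sum, Finset.sum_mul]
      refine Finset.sum_congr rfl fun j _ => ?_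
      rw [Finset.sum_mul]
      refine Finset.sum_congr rfl fun b _ => ?_
      rw [show ((b - j : ℤ) : ℝ) * α = ((-1 * j : ℤ) : ℝ) * α + ((1 * b : ℤ) : ℝ) * α by
        push_cast; ring, e_add]
      ring
    simp_rw [e1]
    rw [intervalIntegral.integral_finsetSum
      (fun j _ => Continuous.intervalIntegrable (by fun_prop) _ _)]
    refine Finset.sum_congr rfl fun j _ => ?_
    rw [intervalIntegral.integral_finsetSum
      (fun j _ => Continuous.intervalIntegrable (by fun_prop) _ _)]
    refine Finset.sum_congr rfl fun b _ => ?_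
    rw [intervalIntegral.integral_const_mul, intervalIntegral.integral_const_mul,
      integral_e_mul_tsum hh]
  have hM0 : 0 ≤ M := (norm_nonneg _).trans (hM 0)
  rw [key, ← integral_norm_sq_sum_e (by norm_num : (-1 : ℤ) ≠ 0) A w,
    ← integral_norm_sq_sum_e one_ne_zero B v, ← intervalIntegral.integral_const_mul,
    ← intervalIntegral.integral_const_mul, ← intervalIntegral.integral_add
      (Continuous.intervalIntegrable (by fun_prop) _ _)
      (Continuous.intervalIntegrable (by fun_prop) _ _), ← intervalIntegral.integral_const_mul]
  refine intervalIntegral.norm_integral_le_of_norm_le zero_le_one ?_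
    (Continuous.intervalIntegrable (by fun_prop) _ _)
  refine Filter.Eventually.of_forall fun α _ => ?_
  change _ ≤ M / 2 * (t * ‖W α‖ ^ 2 + t⁻¹ * ‖V α‖ ^ 2)
  -- The weighted AM-GM inequality replaces Cauchy–Schwarz; the weight t is chosen at the
  -- application.
  have h1 : 2 * (‖W α‖ * ‖V α‖) ≤ t * ‖W α‖ ^ 2 + t⁻¹ * ‖V α‖ ^ 2 := by
    have : 0 ≤ t⁻¹ * (t * ‖W α‖ - ‖V α‖) ^ 2 := by positivity
    have h2 : t⁻¹ * (t * ‖W α‖ - ‖V α‖) ^ 2 =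
      t * ‖W α‖ ^ 2 + t⁻¹ * ‖V α‖ ^ 2 - 2 * (‖W α‖ * ‖V α‖) := by field_simp; ring
    linarith
  rw [norm_mul, norm_mul]
  calc ‖W α‖ * ‖V α‖ * ‖H α‖ ≤ ‖W α‖ * ‖V α‖ * M := by gcongr; exact hM α
    _ = M / 2 * (2 * (‖W α‖ * ‖V α‖)) := by ring
    _ ≤ _ := by gcongr

end FunctionFieldMean

end

noncomputable section

namespace FunctionFieldMean
open Real

/-! ### Differences of coefficients -/

/-- The recursion satisfied by the coefficients of `(1 - X ^ l) * exp (∑_{k < n} χ(k) X ^ k / k)`. -/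
theorem mul_coeff_one_sub_mul_expSeries (χ : ℕ → ℂ) (n l j : ℕ) :
    j * PowerSeries.coeff j ((1 - PowerSeries.X ^ l) * expSeries χ n) =
      ∑ b ∈ Finset.Ico 1 n, χ b * (if b ≤ j then
        PowerSeries.coeff (j - b) ((1 - PowerSeries.X ^ l) * expSeries χ n) else 0) -
      l * (if l ≤ j then PowerSeries.coeff (j - l) (expSeries χ n) else 0) := by
  have hX : PowerSeries.X * PowerSeries.derivative ℂ (PowerSeries.X ^ l : PowerSeries ℂ) =
      PowerSeries.C (l : ℂ) * PowerSeries.X ^ l := by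
    rcases l with _ | l
    · simp
    · rw [Derivation.leibniz_pow, PowerSeries.derivative_X]
      simp only [Nat.add_sub_cancel, nsmul_eq_mul, smul_eq_mul, mul_one, map_natCast]
      ring
  have h : PowerSeries.X * PowerSeries.derivative ℂ ((1 - PowerSeries.X ^ l) * expSeries χ n) =
      (∑ k ∈ Finset.Ico 1 n, PowerSeries.C (χ k) * PowerSeries.X ^ k) *
        ((1 - PowerSeries.X ^ l) * expSeries χ n) -
      PowerSeries.C (l : ℂ) * (PowerSeries.X ^ l * expSeries χ n) := by
    rw [Derivation.leibniz, smul_eq_mul, smul_eq_mul, map_sub, Derivation.map_one_eq_zero]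
    linear_combination (1 - PowerSeries.X ^ l) * X_mul_derivative_expSeries χ n - expSeries χ n * hX
  rw [← coeff_X_mul_derivative, h, map_sub, coeff_sum_mul, PowerSeries.coeff_C_mul,
    PowerSeries.coeff_X_pow_mul']

theorem sum_Ioc_sq_inv_le (U : ℕ) (hU : 0 < U) (s : Finset ℕ) (hs : s ⊆ Finset.Ioc U (2 * U)) {a : ℕ → ℂ}
    (ha : ∀ j, ‖a j‖ ≤ 1) : ∑ j ∈ s, ‖a j / j‖ ^ 2 ≤ 1 / U := by
  have hU0 : (0 : ℝ) < U := by exact_mod_cast hU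
  calc ∑ j ∈ s, ‖a j / j‖ ^ 2 ≤ ∑ j ∈ s, (1 / (U : ℝ)) ^ 2 := by
        refine Finset.sum_le_sum fun j hj => ?_
        have h1 := (Finset.mem_Ioc.mp (hs hj)).1
        have h2 : (U : ℝ) ≤ j := by exact_mod_cast h1.le
        rw [norm_div, Complex.norm_natCast]
        gcongr
        exact ha j
    _ = s.card * (1 / (U : ℝ)) ^ 2 := by rw [Finset.sum_const, nsmul_eq_mul]
    _ ≤ U * (1 / (U : ℝ)) ^ 2 := by
        gcongr
        have := Finset.card_le_card hs
        rw [Nat.card_Ioc] at this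
        omega
    _ = 1 / U := by field_simp

section
variable {χ : ℕ → ℂ} {n l : ℕ} {M : ℝ}

theorem summable_norm_coeff_one_sub_mul (χ : ℕ → ℂ) (n l : ℕ) :
    Summable fun k => ‖PowerSeries.coeff k ((1 - PowerSeries.X ^ l) * expSeries χ n)‖ := by
  have h := (((AbsConverges.one 1).sub (AbsConverges.X_pow 1 l)).mul (absConverges_expSeries χ n 1)).1
  simpa using h

/-- This identifies the symbol of the Toeplitz form as (1 - z^l) E(z) on the unit circle. -/
theorem tsum_coeff_one_sub_mul (χ : ℕ → ℂ) (n l : ℕ) (α : ℝ) :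
    ∑' k : ℕ, PowerSeries.coeff k ((1 - PowerSeries.X ^ l) * expSeries χ n) * e (k * α) =
      (1 - e (l * α)) * Complex.exp (∑ k ∈ Finset.Ico 1 n, χ k * e (k * α) / k) := by
  have h := (((AbsConverges.one (e α)).sub (AbsConverges.X_pow (e α) l)).mul
    (absConverges_expSeries χ n (e α))).2
  simpa only [← e_mul_nat] using h

theorem norm_coeff_expSeries_le (hχ : ∀ k, ‖χ k‖ ≤ 1) (n j : ℕ) :
    ‖PowerSeries.coeff j (expSeries χ n)‖ ≤ 1 := by
  refine (isExpSeq_expSeries χ n).norm_le_one (fun k => ?_) j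
  split_ifs
  · exact hχ k
  · simp

/-- The contribution of a dyadic block. -/
theorem norm_sum_block_le (hχ : ∀ k, ‖χ k‖ ≤ 1)
    (hM : ∀ α, ‖(1 - e (l * α)) * Complex.exp (∑ k ∈ Finset.Ico 1 n, χ k * e (k * α) / k)‖ ≤ M)
    {U : ℕ} (hU : 0 < U) (s : Finset ℕ) (hs : s ⊆ Finset.Ioc U (2 * U)) {a : ℕ → ℂ}
    (ha : ∀ j, ‖a j‖ ≤ 1) :
    ‖∑ j ∈ s, a j * PowerSeries.coeff j ((1 - PowerSeries.X ^ l) * expSeries χ n)‖ ≤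
      3 / 2 * M + l := by
  set h : ℕ → ℂ := fun j => PowerSeries.coeff j ((1 - PowerSeries.X ^ l) * expSeries χ n) with hh
  have hU0 : (0 : ℝ) < U := by exact_mod_cast hU
  -- Only b ≤ j ≤ 2U occur in the recursion for j in the block.
  set B := (Finset.Ico 1 n).filter (· ≤ 2 * U) with hB
  have hM0 : 0 ≤ M := (norm_nonneg _).trans (hM 0)
  -- Second use of the recursion, now at each index of the block.
  have hrec : ∀ j ∈ s, a j * h j = ∑ b ∈ B, a j / j * (χ b * if b ≤ j then h (j - b) else 0) -
      a j / j * (l * (if l ≤ j then PowerSeries.coeff (j - l) (expSeries χ n) else 0)) := by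
    intro j hj
    have hj' := Finset.mem_Ioc.mp (hs hj)
    have hj0 : (j : ℂ) ≠ 0 := by exact_mod_cast (by omega : j ≠ 0)
    have h1 := mul_coeff_one_sub_mul_expSeries χ n l j
    have h2 : ∑ b ∈ B, (χ b * if b ≤ j then h (j - b) else 0) =
        ∑ b ∈ Finset.Ico 1 n, (χ b * if b ≤ j then h (j - b) else 0) := by
      rw [hB, Finset.sum_filter]
      refine Finset.sum_congr rfl fun b _ => ?_
      by_cases hb : b ≤ j
      · rw [if_pos (by omega)]
      · simp [hb]
    rw [← Finset.mul_sum, h2, ← mul_sub, ← h1]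
    simp only [hh]
    field_simp
  rw [Finset.sum_congr rfl hrec, Finset.sum_sub_distrib]
  refine (norm_sub_le _ _).trans (add_le_add ?_ ?_)
  · refine (norm_toeplitz_le (summable_norm_coeff_one_sub_mul χ n l) (M := M)
      (fun α => by rw [tsum_coeff_one_sub_mul]; exact hM α) s B (fun j => a j / j) χ hU0).trans ?_
    have h1 := sum_Ioc_sq_inv_le U hU s hs ha
    have h2 : ∑ b ∈ B, ‖χ b‖ ^ 2 ≤ 2 * U := by
      calc ∑ b ∈ B, ‖χ b‖ ^ 2 ≤ ∑ b ∈ B, (1 : ℝ) :=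
            Finset.sum_le_sum fun b _ => pow_le_one₀ (norm_nonneg _) (hχ b)
        _ = B.card := by simp
        _ ≤ ((2 * U : ℕ) : ℝ) := by
            have : B ⊆ Finset.Icc 1 (2 * U) := by
              intro b; simp [hB]; omega
            have := Finset.card_le_card this
            rw [Nat.card_Icc] at this
            exact_mod_cast this
        _ = 2 * U := by push_cast; rfl
    calc _ ≤ M / 2 * (U * (1 / U) + (U : ℝ)⁻¹ * (2 * U)) := by gcongr
      _ = 3 / 2 * M := by field_simp; ring
  · calc _ ≤ ∑ j ∈ s, 1 / (U : ℝ) * l := by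
          refine norm_sum_le_of_le _ fun j hj => ?_
          have hj' := Finset.mem_Ioc.mp (hs hj)
          have h2 : (U : ℝ) ≤ j := by exact_mod_cast hj'.1.le
          have h3 : ‖(if l ≤ j then PowerSeries.coeff (j - l) (expSeries χ n) else 0)‖ ≤ 1 := by
            split_ifs
            · exact norm_coeff_expSeries_le hχ n _
            · simp
          rw [norm_mul, norm_mul, norm_div, Complex.norm_natCast, Complex.norm_natCast]
          gcongr
          · exact ha j
          · exact mul_le_of_le_one_right (Nat.cast_nonneg l) h3
      _ = s.card * (1 / (U : ℝ) * l) := by rw [Finset.sum_const, nsmul_eq_mul]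
      _ ≤ U * (1 / (U : ℝ) * l) := by
          gcongr
          have := Finset.card_le_card hs
          rw [Nat.card_Ioc] at this
          omega
      _ = l := by field_simp

theorem norm_sum_dyadic_le (hχ : ∀ k, ‖χ k‖ ≤ 1) (hl : 0 < l)
    (hM : ∀ α, ‖(1 - e (l * α)) * Complex.exp (∑ k ∈ Finset.Ico 1 n, χ k * e (k * α) / k)‖ ≤ M)
    (I : ℕ) {a : ℕ → ℂ} (ha : ∀ j, ‖a j‖ ≤ 1) :
    ‖∑ j ∈ Finset.Ioc l (l * 2 ^ I),
      a j * PowerSeries.coeff j ((1 - PowerSeries.X ^ l) * expSeries χ n)‖ ≤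
      I * (3 / 2 * M + l) := by
  induction I with
  | zero => simp
  | succ I ih =>
    have h2 : l * 2 ^ (I + 1) = 2 * (l * 2 ^ I) := by ring
    have hpos : 0 < l * 2 ^ I := by positivity
    have hle : l ≤ l * 2 ^ I := Nat.le_mul_of_pos_right _ (by positivity)
    rw [h2]
    have h3 : Finset.Ioc l (2 * (l * 2 ^ I)) =
        Finset.Ioc l (l * 2 ^ I) ∪ Finset.Ioc (l * 2 ^ I) (2 * (l * 2 ^ I)) := by
      ext j; simp; omega
    rw [h3, Finset.sum_union]
    · refine (norm_add_le _ _).trans ?_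
      have := norm_sum_block_le hχ hM hpos _ subset_rfl ha
      push_cast
      linarith
    · rw [Finset.disjoint_left]
      intro j; simp; omega

/-- Halász's method for `(1 - z ^ l) exp (∑_{k < n} χ(k) z ^ k / k)`. -/
theorem norm_coeff_one_sub_mul_expSeries_le (hχ : ∀ k, ‖χ k‖ ≤ 1) (hl : 0 < l) (hn : 1 ≤ n)
    (hM : ∀ α, ‖(1 - e (l * α)) * Complex.exp (∑ k ∈ Finset.Ico 1 n, χ k * e (k * α) / k)‖ ≤ M)
    {I : ℕ} (hI : n + l ≤ l * 2 ^ I) :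
    (n + l) * ‖PowerSeries.coeff (n + l) ((1 - PowerSeries.X ^ l) * expSeries χ n)‖ ≤
      l + I * (3 / 2 * M + l) := by
  set h : ℕ → ℂ := fun j => PowerSeries.coeff j ((1 - PowerSeries.X ^ l) * expSeries χ n) with hh
  set a : ℕ → ℂ := fun j => if j < n + l then χ (n + l - j) else 0 with ha
  have ha1 : ∀ j, ‖a j‖ ≤ 1 := by
    intro j
    simp only [ha]
    split_ifs
    · exact hχ _
    · simp
  have h1 := mul_coeff_one_sub_mul_expSeries χ n l (n + l)
  -- Substituting j = n + l - b gives l < j < n + l. Starting above l is what limits the number of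
  -- dyadic blocks to about log₂(2n/l).
  have h2 : ∑ b ∈ Finset.Ico 1 n, χ b * (if b ≤ n + l then
        PowerSeries.coeff (n + l - b) ((1 - PowerSeries.X ^ l) * expSeries χ n) else 0) =
      ∑ j ∈ Finset.Ioc l (l * 2 ^ I), a j * h j := by
    have : ∑ j ∈ Finset.Ioc l (l * 2 ^ I), a j * h j = ∑ j ∈ Finset.Ioo l (n + l), χ (n + l - j) * h j := by
      simp only [ha, ite_mul, zero_mul]
      rw [← Finset.sum_filter]
      refine Finset.sum_congr ?_ fun _ _ => rfl
      ext j; simp; omega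
    rw [this]
    refine Finset.sum_nbij' (fun b => n + l - b) (fun j => n + l - j) ?_ ?_ ?_ ?_ ?_
    · intro b; simp; omega
    · intro j; simp; omega
    · intro b; simp; omega
    · intro j; simp; omega
    · intro b hb
      rw [Finset.mem_Ico] at hb
      rw [if_pos (by omega), show n + l - (n + l - b) = b by omega]
  rw [h2] at h1
  have h3 := norm_sum_dyadic_le hχ hl hM I ha1
  have h4 : ‖((n + l : ℕ) : ℂ) * h (n + l)‖ ≤ I * (3 / 2 * M + l) + l := by
    simp only [hh]
    rw [h1]
    refine (norm_sub_le _ _).trans (add_le_add h3 ?_)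
    rw [norm_mul, Complex.norm_natCast]
    refine mul_le_of_le_one_right (Nat.cast_nonneg l) ?_
    split_ifs
    · exact norm_coeff_expSeries_le hχ n _
    · simp
  rw [norm_mul, Complex.norm_natCast] at h4
  push_cast at h4
  linarith

end

/-- The coefficient of X^(n+l) in (1 - X^l) E is the difference of the truncated sequence at n + l
and n; restoring σ costs (3l+1)/n and 1/n. -/
theorem IsExpSeq.norm_sub_shift_le {χ σ : ℕ → ℂ} (h : IsExpSeq χ σ) (hχ : ∀ k, ‖χ k‖ ≤ 1) {n l : ℕ}
    {M : ℝ} (hl : 0 < l) (hn : 1 ≤ n)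
    (hM : ∀ α, ‖(1 - e (l * α)) * Complex.exp (∑ k ∈ Finset.Ico 1 n, χ k * e (k * α) / k)‖ ≤ M)
    {I : ℕ} (hI : n + l ≤ l * 2 ^ I) :
    ‖σ (n + l) - σ n‖ ≤ (6 * l + I * (3 / 2 * M + l)) / n := by
  have hn0 : (0 : ℝ) < n := by exact_mod_cast hn
  have hl0 : (1 : ℝ) ≤ l := by exact_mod_cast hl
  set g : ℕ → ℂ := fun j => PowerSeries.coeff j (expSeries χ n) with hg
  have h1 := h.norm_sub_le hn (isExpSeq_expSeries χ n) hχ l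
  have h2 := h.norm_sub_le hn (isExpSeq_expSeries χ n) hχ 0
  have h3 := norm_coeff_one_sub_mul_expSeries_le hχ hl hn hM hI
  have h4 : PowerSeries.coeff (n + l) ((1 - PowerSeries.X ^ l) * expSeries χ n) =
      g (n + l) - g n := by
    rw [sub_mul, one_mul, map_sub, PowerSeries.coeff_X_pow_mul', if_pos (by omega),
      Nat.add_sub_cancel]
  rw [h4] at h3
  have h5 : σ (n + l) - σ n = (σ (n + l) - g (n + l)) + (g (n + l) - g n) - (σ n - g n) := by ring
  rw [h5]
  refine (_root_.norm_sub_le _ _).trans ((add_le_add (norm_add_le _ _) le_rfl).trans ?_)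
  have h6 : ‖g (n + l) - g n‖ ≤ (l + I * (3 / 2 * M + l)) / n := by
    rw [le_div_iff₀ hn0]
    nlinarith [norm_nonneg (g (n + l) - g n)]
  simp only [Nat.cast_zero, mul_zero, zero_add, add_zero] at h2
  have h7 : (6 * l + I * (3 / 2 * M + l)) / n = (3 * l + 1) / n + (l + I * (3 / 2 * M + l)) / n +
      1 / n + (2 * l - 2) / n := by ring
  have h8 : 0 ≤ (2 * l - 2 : ℝ) / n := div_nonneg (by linarith) hn0.le
  linarith

end FunctionFieldMean

end

noncomputable section

namespace FunctionFieldMean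
open Real

/-! ### The Lipschitz estimate for sequences -/

theorem norm_one_add_e (x : ℝ) : ‖1 + e x‖ = 2 * |cos (π * x)| := by
  have h : 1 + e x = e (x / 2) * (2 * cos (π * x) : ℝ) := by
    have h1 : e x = e (x / 2) * e (x / 2) := by rw [← e_add, add_halves]
    have h2 : (1 : ℂ) = e (x / 2) * e (-(x / 2)) := by rw [← e_add, add_neg_cancel, e_zero]
    have h3 : ((2 * cos (π * x) : ℝ) : ℂ) = e (x / 2) + e (-(x / 2)) := by
      rw [Complex.ofReal_mul, Complex.ofReal_cos, Complex.cos, e, e]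
      push_cast
      rw [mul_div_cancel₀ _ (two_ne_zero' ℂ)]
      congr 2 <;> ring
    rw [h3, mul_add, ← h1, ← h2, add_comm]
  rw [h, norm_mul, norm_e, one_mul, Complex.norm_real, norm_mul, norm_eq_abs (cos _)]
  norm_num

/-- The hypothesis gives |E(z)|² ≤ |E(z) E(1)|, and the exponent on the right has real part at most
∑ |1 + e(kα)| / k. -/
theorem norm_exp_le_exp_sum_abs_cos {χ : ℕ → ℂ} (hχ : ∀ k, ‖χ k‖ ≤ 1) {n : ℕ} {α : ℝ}
    (h : ‖Complex.exp (∑ k ∈ Finset.Ico 1 n, χ k * e (k * α) / k)‖ ≤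
      ‖Complex.exp (∑ k ∈ Finset.Ico 1 n, χ k / k)‖) :
    ‖Complex.exp (∑ k ∈ Finset.Ico 1 n, χ k * e (k * α) / k)‖ ≤
      exp (∑ k ∈ Finset.Ico 1 n, |cos (π * (k * α))| / k) := by
  rw [Complex.norm_exp, Complex.norm_exp, exp_le_exp] at h
  rw [Complex.norm_exp, exp_le_exp]
  have h1 : (∑ k ∈ Finset.Ico 1 n, χ k * e (k * α) / k).re + (∑ k ∈ Finset.Ico 1 n, χ k / k).re ≤
      ∑ k ∈ Finset.Ico 1 n, 2 * (|cos (π * (k * α))| / k) := by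
    rw [← Complex.add_re, ← Finset.sum_add_distrib, Complex.re_sum]
    refine Finset.sum_le_sum fun k _ => ?_
    refine (Complex.re_le_norm _).trans ?_
    rw [show χ k * e (k * α) / k + χ k / k = χ k * (1 + e (k * α)) / k by ring, norm_div, norm_mul,
      Complex.norm_natCast, norm_one_add_e, ← mul_div_assoc]
    refine div_le_div_of_nonneg_right ?_ (Nat.cast_nonneg k)
    exact mul_le_of_le_one_left (by positivity) (hχ k)
  rw [← Finset.mul_sum] at h1
  linarith

theorem exists_norm_sub_shift_le : ∃ C A : ℝ, 0 < C ∧ 0 < A ∧ ∀ (χ σ : ℕ → ℂ), IsExpSeq χ σ →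
    (∀ k, ‖χ k‖ ≤ 1) → ∀ n : ℕ, 2 ≤ n →
    (∀ α : ℝ, ‖Complex.exp (∑ k ∈ Finset.Ico 1 n, χ k * e (k * α) / k)‖ ≤
      ‖Complex.exp (∑ k ∈ Finset.Ico 1 n, χ k / k)‖) →
    ∀ l : ℕ, 1 ≤ l → l ≤ n → ∀ m : ℕ, IsLeast {k : ℕ | Odd k ∧ ¬ k ∣ l} m →
      ‖σ (n + l) - σ n‖ ≤ C * (((l : ℝ) / n) ^ (1 - 2 / π) * log (2 * n / l) +
        log n ^ A / (n : ℝ) ^ (1 - c m)) := by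
  obtain ⟨C, B, hC, hB, hM⟩ := exists_norm_one_sub_mul_exp_le
  refine ⟨(15 + 9 / 2 * C) * 3 ^ (B + 1), B + 1, by positivity, by positivity, ?_⟩
  intro χ σ hσ hχ n hn hmax l hl hln m hm
  have hn0 : (2 : ℝ) ≤ n := by exact_mod_cast hn
  have hn0' : (0 : ℝ) < n := by linarith
  have hl0 : (1 : ℝ) ≤ l := by exact_mod_cast hl
  have hl0' : (0 : ℝ) < l := by linarith
  have hln0 : (l : ℝ) ≤ n := by exact_mod_cast hln
  have hlog2 := log_two_gt_d9
  have hlogn : log 2 ≤ log n := log_le_log (by norm_num) hn0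
  set M := C * ((n : ℝ) ^ (2 / π) * (l : ℝ) ^ (1 - 2 / π) + (n : ℝ) ^ c m * (1 + log n) ^ B) with hMdef
  have hM0 : 0 ≤ M := by
    have : 0 ≤ 1 + log n := by linarith
    positivity
  have hMα : ∀ α, ‖(1 - e (l * α)) *
      Complex.exp (∑ k ∈ Finset.Ico 1 n, χ k * e (k * α) / k)‖ ≤ M := by
    intro α
    refine le_trans ?_ (hM n l m α (by omega) hl hm)
    rw [norm_mul]
    gcongr
    exact norm_exp_le_exp_sum_abs_cos hχ (hmax α)
  set L := log (2 * n / l) with hL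
  have h2nl : (2 : ℝ) ≤ 2 * n / l := by rw [le_div_iff₀ hl0']; linarith
  have hL2 : log 2 ≤ L := log_le_log (by norm_num) h2nl
  have hLn : L ≤ 3 * log n := by
    have h1 : L ≤ log (2 * n) := by
      apply log_le_log (by positivity)
      exact div_le_self (by linarith) hl0
    rw [log_mul (by norm_num) hn0'.ne'] at h1
    linarith
  -- Number of dyadic blocks needed to reach 2n ≥ n + l from l.
  set I := ⌈L / log 2⌉₊ with hI
  have hI1 : L / log 2 ≤ I := Nat.le_ceil _
  have hI2 : (I : ℝ) ≤ 3 * L := by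
    have h1 : (I : ℝ) < L / log 2 + 1 := Nat.ceil_lt_add_one (by apply div_nonneg <;> linarith)
    have h2 : L / log 2 + 1 ≤ 3 * L := by
      rw [← le_sub_iff_add_le, div_le_iff₀ (by linarith)]
      nlinarith
    linarith
  have hI3 : n + l ≤ l * 2 ^ I := by
    have h1 : (2 * n / l : ℝ) ≤ 2 ^ I := by
      rw [div_le_iff₀ (by linarith)] at hI1
      rw [← log_le_log_iff (by linarith) (by positivity), log_pow]
      exact hI1
    rw [div_le_iff₀ hl0'] at h1
    have h2 : ((n + l : ℕ) : ℝ) ≤ ((l * 2 ^ I : ℕ) : ℝ) := by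
      push_cast; linarith
    exact_mod_cast h2
  have h1 := hσ.norm_sub_shift_le hχ hl (by omega) hMα hI3
  set x := 1 - 2 / π with hx
  have hx0 : 0 < 2 / π := by positivity
  have hx1 : 2 / π ≤ 1 := by rw [div_le_one pi_pos]; linarith [pi_gt_three]
  set R := ((l : ℝ) / n) ^ x with hR
  have hR0 : 0 < R := by positivity
  -- Since l/n ≤ 1 and the exponent is at most 1, all errors O(l/n) disappear into the main term.
  have hlR : (l : ℝ) / n ≤ R := by
    have := rpow_le_rpow_of_exponent_ge (x := (l : ℝ) / n) (by positivity)
      (by rw [div_le_one hn0']; exact hln0) (show x ≤ 1 by linarith)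
    rwa [rpow_one] at this
  set Y := (n : ℝ) ^ (1 - c m) with hY
  have hY0 : 0 < Y := by positivity
  have hMn : M / n = C * (R + (1 + log n) ^ B / Y) := by
    have e1 : (n : ℝ) ^ (2 / π) * (l : ℝ) ^ x / n = R := by
      rw [hR, div_rpow hl0'.le hn0'.le, show 2 / π = 1 - x by rw [hx]; ring, rpow_sub hn0', rpow_one]
      field_simp
    have e2 : (n : ℝ) ^ c m / n = 1 / Y := by
      rw [hY, rpow_sub hn0', rpow_one]
      field_simp
    calc M / n = C * ((n : ℝ) ^ (2 / π) * (l : ℝ) ^ x / n + (n : ℝ) ^ c m / n * (1 + log n) ^ B) := by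
          rw [hMdef]; ring
      _ = _ := by rw [e1, e2]; ring
  have hlogB : L * (1 + log n) ^ B ≤ 3 ^ (B + 1) * log n ^ (B + 1) := by
    have h0 : 0 ≤ 3 * log n := by linarith
    calc L * (1 + log n) ^ B ≤ (3 * log n) * (3 * log n) ^ B := by
          gcongr
          · linarith
      _ = (3 * log n) ^ (B + 1) := by
          rw [rpow_add_one (by linarith)]; ring
      _ = _ := mul_rpow (by norm_num) (by linarith)
  set W := log n ^ (B + 1) / Y with hW
  have hW0 : 0 ≤ W := by
    have : 0 ≤ log n := by linarith
    positivity
  have h3B : (1 : ℝ) ≤ 3 ^ (B + 1) := one_le_rpow (by norm_num) (by linarith)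
  have hLM : L * (M / n) ≤ C * 3 ^ (B + 1) * (R * L + W) := by
    rw [hMn]
    have e1 : L * ((1 + log n) ^ B / Y) ≤ 3 ^ (B + 1) * W := by
      rw [hW, ← mul_div_assoc, ← mul_div_assoc]
      gcongr
    have e2 : R * L ≤ 3 ^ (B + 1) * (R * L) :=
      le_mul_of_one_le_left (mul_nonneg hR0.le (by linarith)) h3B
    calc L * (C * (R + (1 + log n) ^ B / Y)) = C * (R * L + L * ((1 + log n) ^ B / Y)) := by ring
      _ ≤ C * (3 ^ (B + 1) * (R * L) + 3 ^ (B + 1) * W) := by gcongr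
      _ = _ := by ring
  have hRL : 0 ≤ R * L := mul_nonneg hR0.le (by linarith)
  have hfirst : 6 * (l / n : ℝ) + 3 * L * (l / n) ≤ 15 * (R * L) := by
    have e1 : (l / n : ℝ) ≤ 2 * (R * L) := by nlinarith
    have e2 : L * (l / n : ℝ) ≤ R * L := by
      rw [mul_comm R]; exact mul_le_mul_of_nonneg_left hlR (by linarith)
    linarith
  calc ‖σ (n + l) - σ n‖ ≤ (6 * l + I * (3 / 2 * M + l)) / n := h1
    _ ≤ (6 * l + 3 * L * (3 / 2 * M + l)) / n := by gcongr
    _ = (6 * (l / n) + 3 * L * (l / n)) + 9 / 2 * (L * (M / n)) := by ring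
    _ ≤ 15 * (R * L) + 9 / 2 * (C * 3 ^ (B + 1) * (R * L + W)) := by gcongr
    _ ≤ (15 + 9 / 2 * C) * 3 ^ (B + 1) * (R * L + W) := by
        have e1 : 15 * (R * L) ≤ 15 * (3 ^ (B + 1) * (R * L + W)) := by
          have : R * L + W ≤ 3 ^ (B + 1) * (R * L + W) := le_mul_of_one_le_left (by positivity) h3B
          linarith
        linarith

end FunctionFieldMean

end

noncomputable section

namespace FunctionFieldMean
open Polynomial
variable {K : Type*} [Field K]

/-! ### The convolution identity for multiplicative functions -/

/-- Compare coefficients in T E' = (T E'/E) · E, where E is the Euler factor at P. -/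
theorem sum_lambda_mul_pow {f : K[X] → ℂ} (h1 : f 1 = 1) {P : K[X]} (hm : P.Monic)
    (hi : Irreducible P) (v : ℕ) :
    ∑ i ∈ Finset.Icc 1 v, lambda f (P ^ i) * f (P ^ (v - i)) = P.natDegree * v * f (P ^ v) := by
  set E := eulerFactor f P with hE
  have hE0 : PowerSeries.constantCoeff E ≠ 0 := by
    rw [← PowerSeries.coeff_zero_eq_constantCoeff_apply, hE, eulerFactor, PowerSeries.coeff_mk,
      pow_zero, h1]
    exact one_ne_zero
  have hL : PowerSeries.X * PowerSeries.derivative ℂ E * E⁻¹ * E =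
      PowerSeries.X * PowerSeries.derivative ℂ E := by
    rw [mul_assoc, PowerSeries.inv_mul_cancel _ hE0, mul_one]
  have h := congrArg (PowerSeries.coeff v) hL
  rw [coeff_X_mul_derivative, PowerSeries.coeff_mul,
    Finset.Nat.sum_antidiagonal_eq_sum_range_succ_mk, Finset.sum_range_succ'] at h
  rw [mul_assoc]
  have hv : PowerSeries.coeff v E = f (P ^ v) := PowerSeries.coeff_mk _ _
  have h0 : PowerSeries.coeff 0 (PowerSeries.X * PowerSeries.derivative ℂ E * E⁻¹) = 0 := by
    simp
  simp only [h0, zero_mul, add_zero, hv] at h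
  rw [← h, Finset.mul_sum, Finset.range_eq_Ico, Finset.sum_Ico_add' (fun k =>
    (P.natDegree : ℂ) * (PowerSeries.coeff k (PowerSeries.X * PowerSeries.derivative ℂ E * E⁻¹) *
      PowerSeries.coeff (v - k) E)) 0 v 1, zero_add]
  refine Finset.sum_congr rfl fun i hi' => ?_
  rw [lambda, onPrimePowers_pow _ hm hi (by simp at hi'; omega), hE, eulerFactor,
    PowerSeries.coeff_mk]
  ring

theorem lambda_eq_zero_of_natDegree {f : K[X] → ℂ} {F : K[X]} (hF : F.natDegree = 0) :
    lambda f F = 0 := by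
  refine onPrimePowers_of_not _ ?_
  rintro ⟨P, k, -, hi, hk, rfl⟩
  rw [natDegree_pow] at hF
  exact absurd hF (mul_pos hk hi.natDegree_pos).ne'

/-- Subtract `sum_lambda_mul_pow` for f = 1 at consecutive exponents. The prime polynomial theorem
thus becomes a case of the convolution identity. -/
theorem vonMangoldt_eq_lambda {F : K[X]} : (vonMangoldt F : ℂ) = lambda (fun _ => 1) F := by
  by_cases h : ∃ P k, IsPrimePower F P k
  · obtain ⟨P, k, hm, hi, hk, rfl⟩ := h
    rw [vonMangoldt, onPrimePowers_pow _ hm hi hk]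
    obtain ⟨j, rfl⟩ : ∃ j, k = j + 1 := ⟨k - 1, by omega⟩
    have h1 := sum_lambda_mul_pow (f := fun _ => (1 : ℂ)) rfl hm hi (j + 1)
    have h2 := sum_lambda_mul_pow (f := fun _ => (1 : ℂ)) rfl hm hi j
    rw [Finset.sum_Icc_succ_top (by omega)] at h1
    simp only [mul_one] at h1 h2
    rw [h2] at h1
    push_cast at h1 ⊢
    linear_combination -h1
  · rw [vonMangoldt, lambda, onPrimePowers_of_not _ h, onPrimePowers_of_not _ h]
    simp

section
open UniqueFactorizationMonoid

theorem mem_normalizedFactors_iff_monic [DecidableEq K] {F P : K[X]} (hF : F.Monic) :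
    P ∈ normalizedFactors F ↔ P.Monic ∧ Irreducible P ∧ P ∣ F := by
  rw [mem_normalizedFactors_iff' hF.ne_zero]
  constructor
  · rintro ⟨hi, hn, hd⟩
    refine ⟨?_, hi, hd⟩
    rw [← hn]
    exact monic_normalize hi.ne_zero
  · rintro ⟨hm, hi, hd⟩
    exact ⟨hi, hm.normalize_eq_self, hd⟩

theorem pow_dvd_iff_le_count [DecidableEq K] {F P : K[X]} (hF : F.Monic) (hm : P.Monic) (hi : Irreducible P)
    (k : ℕ) : P ^ k ∣ F ↔ k ≤ (normalizedFactors F).count P := by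
  rw [pow_dvd_iff_le_emultiplicity, emultiplicity_eq_count_normalizedFactors hi hF.ne_zero,
    hm.normalize_eq_self]
  exact Nat.cast_le

theorem sum_count_mul_natDegree [DecidableEq K] {F : K[X]} (hF : F.Monic) :
    ∑ P ∈ (normalizedFactors F).toFinset, (normalizedFactors F).count P * P.natDegree =
      F.natDegree := by
  have h1 : (normalizedFactors F).prod = F := by
    rw [prod_normalizedFactors_eq hF.ne_zero, hF.normalize_eq_self]
  conv_rhs => rw [← h1]
  rw [natDegree_multiset_prod_of_monic _ fun P hP => ((mem_normalizedFactors_iff_monic hF).mp hP).1,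
    Finset.sum_multiset_map_count]
  rfl

variable [Finite K]

open Classical in
/-- `f(F) deg F` is the sum of `Λ_f(G) f(F / G)` over the divisors `G` of `F`. -/
theorem natDegree_mul_eq_sum {f : K[X] → ℂ} (hf : IsMultiplicative f) (h1 : f 1 = 1) {F : K[X]}
    (hF : F.Monic) :
    F.natDegree * f F = ∑ x ∈ (Finset.Icc 1 F.natDegree).sigma (monics K),
      if x.2 ∣ F then lambda f x.2 * f (F / x.2) else 0 := by
  set S := (normalizedFactors F).toFinset with hS
  set v : K[X] → ℕ := fun P => (normalizedFactors F).count P with hv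
  have hSm : ∀ P ∈ S, P.Monic ∧ Irreducible P ∧ P ∣ F := fun P hP =>
    (mem_normalizedFactors_iff_monic hF).mp (Multiset.mem_toFinset.mp hP)
  -- Write F = P^v H with P not dividing H; multiplicativity extracts f(H) and leaves the local
  -- identity at P.
  have hlocal : ∀ P ∈ S, ∑ i ∈ Finset.Icc 1 (v P), lambda f (P ^ i) * f (F / P ^ i) =
      (v P * P.natDegree : ℕ) * f F := by
    intro P hP
    obtain ⟨hm, hi, -⟩ := hSm P hP
    obtain ⟨H, hH⟩ := (pow_dvd_iff_le_count hF hm hi (v P)).mpr le_rfl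
    have hHm : H.Monic := (hm.pow (v P)).of_mul_monic_left (hH ▸ hF)
    have hPH : ¬ P ∣ H := by
      rintro ⟨H', hH'⟩
      have : P ^ (v P + 1) ∣ F := ⟨H', by rw [hH, hH', pow_succ, mul_assoc]⟩
      rw [pow_dvd_iff_le_count hF hm hi] at this
      simp only [hv] at this
      omega
    have hco : IsCoprime P H := (hi.coprime_iff_not_dvd).mpr hPH
    have hfac : ∀ j, f (P ^ j * H) = f (P ^ j) * f H := fun j =>
      hf _ _ (hm.pow j) hHm hco.pow_left
    have : ∀ i ∈ Finset.Icc 1 (v P), lambda f (P ^ i) * f (F / P ^ i) =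
        lambda f (P ^ i) * f (P ^ (v P - i)) * f H := by
      intro i hi'
      rw [Finset.mem_Icc] at hi'
      have : F / P ^ i = P ^ (v P - i) * H := by
        conv_lhs => rw [hH]
        rw [← Nat.add_sub_cancel' hi'.2, pow_add, mul_assoc,
          mul_div_cancel_left₀ _ (hm.pow i).ne_zero, Nat.add_sub_cancel_left]
      rw [this, hfac, mul_assoc]
    rw [Finset.sum_congr rfl this, ← Finset.sum_mul, sum_lambda_mul_pow h1 hm hi]
    conv_rhs => rw [hH, hfac]
    push_cast
    ring
  have hdeg : (F.natDegree : ℂ) * f F = ∑ P ∈ S, ∑ i ∈ Finset.Icc 1 (v P),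
      lambda f (P ^ i) * f (F / P ^ i) := by
    rw [Finset.sum_congr rfl hlocal, ← Finset.sum_mul, ← Nat.cast_sum]
    simp only [hS, hv]
    rw [sum_count_mul_natDegree hF]
  rw [hdeg, Finset.sum_sigma']
  -- Pairs (P, i) are identified with prime power divisors of F; every other divisor has Λ_f = 0.
  -- Recording the degree makes the index set depend on deg F only, which permits summing over F
  -- first.
  refine Finset.sum_of_injOn (fun y => ⟨(y.1 ^ y.2).natDegree, y.1 ^ y.2⟩) ?_ ?_ ?_ ?_
  · rintro ⟨P, i⟩ hy ⟨Q, j⟩ hy' h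
    simp only [Finset.coe_sigma, Set.mem_sigma_iff, Finset.mem_coe, Finset.mem_Icc] at hy hy'
    have h2 : P ^ i = Q ^ j := by
      have := congrArg (fun x : (_ : ℕ) × K[X] => x.2) h
      exact this
    obtain ⟨rfl, rfl⟩ := isPrimePower_unique (F := P ^ i)
      ⟨(hSm P hy.1).1, (hSm P hy.1).2.1, by omega, rfl⟩
      ⟨(hSm Q hy'.1).1, (hSm Q hy'.1).2.1, by omega, h2⟩
    rfl
  · rintro ⟨P, i⟩ hy
    simp only [Finset.coe_sigma, Set.mem_sigma_iff, Finset.mem_coe, Finset.mem_Icc] at hy ⊢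
    obtain ⟨hm, hi, -⟩ := hSm P hy.1
    refine ⟨⟨?_, ?_⟩, mem_monics.mpr ⟨hm.pow i, rfl⟩⟩
    · rw [natDegree_pow]
      exact mul_pos (by omega) hi.natDegree_pos
    · exact natDegree_le_of_dvd ((pow_dvd_iff_le_count hF hm hi i).mpr hy.2.2) hF.ne_zero
  · rintro ⟨k, G⟩ hx hx'
    split_ifs with hGF
    · rw [lambda, onPrimePowers_of_not, zero_mul]
      rintro ⟨P, i, hm, hi, hi0, hGP⟩
      simp only at hGP hGF
      subst hGP
      apply hx'
      have hle := (pow_dvd_iff_le_count hF hm hi i).mp hGF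
      refine ⟨⟨P, i⟩, ?_, ?_⟩
      · simp only [Finset.coe_sigma, Set.mem_sigma_iff, Finset.mem_coe, Finset.mem_Icc, hS,
          Multiset.mem_toFinset]
        exact ⟨(mem_normalizedFactors_iff_monic hF).mpr ⟨hm, hi, (dvd_pow_self P hi0.ne').trans hGF⟩,
          hi0, hle⟩
      · simp only [Finset.mem_sigma, mem_monics] at hx
        simp only [hx.2.2]
    · rfl
  · rintro ⟨P, i⟩ hy
    rw [Finset.mem_sigma, Finset.mem_Icc] at hy
    obtain ⟨hm, hi, -⟩ := hSm P hy.1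
    rw [if_pos ((pow_dvd_iff_le_count hF hm hi i).mpr hy.2.2)]

open Classical in
-- Exchange the sums and write F = GH. The general semiring serves both the complex identity and its
-- real version with norms.
theorem sum_monics_sum_dvd {R : Type*} [CommSemiring R] (a b : K[X] → R) (n : ℕ) :
    ∑ F ∈ monics K n, ∑ x ∈ (Finset.Icc 1 n).sigma (monics K),
      (if x.2 ∣ F then a x.2 * b (F / x.2) else 0) =
    ∑ k ∈ Finset.Icc 1 n, (∑ G ∈ monics K k, a G) * ∑ H ∈ monics K (n - k), b H := by
  rw [Finset.sum_comm, Finset.sum_sigma]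
  refine Finset.sum_congr rfl fun k hk => ?_
  rw [Finset.mem_Icc] at hk
  rw [Finset.sum_mul]
  refine Finset.sum_congr rfl fun G hG => ?_
  rw [mem_monics] at hG
  rw [Finset.mul_sum, ← Finset.sum_filter]
  symm
  refine Finset.sum_nbij (fun H => G * H) ?_ ?_ ?_ ?_
  · intro H hH
    rw [mem_monics] at hH
    simp only [Finset.mem_filter, mem_monics, dvd_mul_right, and_true]
    refine ⟨hG.1.mul hH.1, ?_⟩
    rw [hG.1.natDegree_mul hH.1, hG.2, hH.2]
    omega
  · intro H _ H' _ h
    exact mul_left_cancel₀ hG.1.ne_zero h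
  · intro F hF
    simp only [Finset.coe_filter, Set.mem_ofPred_eq, mem_monics] at hF
    obtain ⟨⟨hFm, hFn⟩, H, rfl⟩ := hF
    have hHm : H.Monic := hG.1.of_mul_monic_left hFm
    refine ⟨H, ?_, rfl⟩
    rw [Finset.mem_coe, mem_monics]
    refine ⟨hHm, ?_⟩
    rw [hG.1.natDegree_mul hHm, hG.2] at hFn
    omega
  · intro H _
    rw [mul_div_cancel_left₀ _ hG.1.ne_zero]

theorem natCast_mul_sum_monics {f : K[X] → ℂ} (hf : IsMultiplicative f) (h1 : f 1 = 1) (n : ℕ) :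
    n * ∑ F ∈ monics K n, f F =
      ∑ k ∈ Finset.Icc 1 n, (∑ G ∈ monics K k, lambda f G) * ∑ H ∈ monics K (n - k), f H := by
  classical
  rw [← sum_monics_sum_dvd, Finset.mul_sum]
  refine Finset.sum_congr rfl fun F hF => ?_
  rw [mem_monics] at hF
  rw [← hF.2, natDegree_mul_eq_sum hf h1 hF.1]

theorem natCast_mul_sum_norm_monics_le {f : K[X] → ℂ} (hf : IsMultiplicative f) (h1 : f 1 = 1)
    (n : ℕ) : n * ∑ F ∈ monics K n, ‖f F‖ ≤
      ∑ k ∈ Finset.Icc 1 n, (∑ G ∈ monics K k, ‖lambda f G‖) * ∑ H ∈ monics K (n - k), ‖f H‖ := by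
  classical
  rw [← sum_monics_sum_dvd (fun G => ‖lambda f G‖) (fun H => ‖f H‖), Finset.mul_sum]
  refine Finset.sum_le_sum fun F hF => ?_
  rw [mem_monics] at hF
  have h := congrArg norm (natDegree_mul_eq_sum hf h1 hF.1)
  rw [norm_mul, Complex.norm_natCast, hF.2] at h
  rw [h]
  refine norm_sum_le_of_le _ fun x _ => ?_
  split_ifs
  · rw [norm_mul]
  · simp

end

end FunctionFieldMean

end

noncomputable section

namespace FunctionFieldMean
open Polynomial
variable {K : Type*} [Field K] [Finite K]

/-! ### Mean values over the polynomials of a given degree -/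

theorem card_monics (n : ℕ) : (monics K n).card = Nat.card K ^ n := by
  have h1 : (monics K n).card = Nat.card {F : K[X] // F.Monic ∧ F.natDegree = n} := by
    rw [monics, ← Set.ncard_eq_toFinset_card _ (finite_monic_natDegree K n), ← Nat.card_coe_set_eq]
    rfl
  rw [h1, Nat.card_congr ((monicEquivDegreeLT n).trans (degreeLTEquiv K n).toEquiv), Nat.card_fun,
    Nat.card_fin]

theorem natCard_pos : (0 : ℝ) < Nat.card K := by exact_mod_cast Nat.card_pos

theorem monics_zero : monics K 0 = {1} := by
  ext F
  rw [mem_monics, Finset.mem_singleton]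
  constructor
  · rintro ⟨h1, h2⟩
    exact h1.natDegree_eq_zero.mp h2
  · rintro rfl
    exact ⟨monic_one, natDegree_one⟩

/-- The mean value of `Λ_f` over monic polynomials of degree `k`. -/
def chi (f : K[X] → ℂ) (k : ℕ) : ℂ := (∑ G ∈ monics K k, lambda f G) / (Nat.card K : ℂ) ^ k

/-- The prime polynomial theorem. -/
theorem sum_vonMangoldt (n : ℕ) (hn : 1 ≤ n) :
    ∑ F ∈ monics K n, vonMangoldt F = (Nat.card K : ℝ) ^ n := by
  have hq : (Nat.card K : ℂ) ≠ 0 := by exact_mod_cast natCard_pos (K := K) |>.ne'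
  -- For f = 1 the convolution identity, divided by q^n, says that the means of Λ up to degree n sum
  -- to n; consecutive differences give 1.
  have h1 : ∀ n : ℕ, ∑ k ∈ Finset.Icc 1 n, chi (K := K) (fun _ => 1) k = n := by
    intro n
    have h := natCast_mul_sum_monics (K := K) (f := fun _ => (1 : ℂ)) (fun _ _ _ _ _ => by simp) rfl n
    simp only [Finset.sum_const, card_monics, nsmul_eq_mul, mul_one] at h
    push_cast at h
    have h2 : ∑ k ∈ Finset.Icc 1 n, chi (K := K) (fun _ => 1) k * (Nat.card K : ℂ) ^ n =
        n * (Nat.card K : ℂ) ^ n := by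
      rw [h]
      refine Finset.sum_congr rfl fun k hk => ?_
      rw [Finset.mem_Icc] at hk
      rw [chi, ← Nat.add_sub_cancel' hk.2, pow_add, Nat.add_sub_cancel_left]
      field_simp
    rw [← Finset.sum_mul] at h2
    exact mul_right_cancel₀ (pow_ne_zero n hq) h2
  obtain ⟨j, rfl⟩ : ∃ j, n = j + 1 := ⟨n - 1, by omega⟩
  have h2 := h1 (j + 1)
  rw [Finset.sum_Icc_succ_top (by omega), h1 j, chi] at h2
  push_cast at h2
  have h3 : (∑ G ∈ monics K (j + 1), lambda (fun _ => 1) G) / (Nat.card K : ℂ) ^ (j + 1) = 1 := by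
    linear_combination h2
  rw [div_eq_one_iff_eq (pow_ne_zero _ hq)] at h3
  have h4 : ((∑ F ∈ monics K (j + 1), vonMangoldt F : ℝ) : ℂ) = ((Nat.card K : ℝ) ^ (j + 1) : ℝ) := by
    push_cast
    rw [← h3]
    exact Finset.sum_congr rfl fun F _ => vonMangoldt_eq_lambda
  exact_mod_cast h4

theorem sum_norm_lambda_le {f : K[X] → ℂ} (hf : InClass 1 f) (k : ℕ) :
    ∑ G ∈ monics K k, ‖lambda f G‖ ≤ (Nat.card K : ℝ) ^ k := by
  rcases Nat.eq_zero_or_pos k with rfl | hk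
  · rw [monics_zero, Finset.sum_singleton, lambda_eq_zero_of_natDegree natDegree_one]
    simp
  · rw [← sum_vonMangoldt k hk]
    refine Finset.sum_le_sum fun F hF => ?_
    simpa using hf.norm_lambda_le F (mem_monics.mp hF).1

theorem norm_chi_le_one {f : K[X] → ℂ} (hf : InClass 1 f) (k : ℕ) : ‖chi f k‖ ≤ 1 := by
  rw [chi, norm_div, norm_pow, Complex.norm_natCast, div_le_one (pow_pos natCard_pos k)]
  exact (norm_sum_le _ _).trans (sum_norm_lambda_le hf k)

theorem isExpSeq_sigma {f : K[X] → ℂ} (hf : IsMultiplicative f) (h1 : f 1 = 1) :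
    IsExpSeq (chi f) (sigma f) := by
  have hq : (Nat.card K : ℂ) ≠ 0 := by exact_mod_cast natCard_pos (K := K) |>.ne'
  refine ⟨by simp [sigma, monics_zero, h1], fun n => ?_⟩
  rw [sigma, mul_div_assoc', natCast_mul_sum_monics hf h1, Finset.sum_div]
  refine Finset.sum_congr rfl fun k hk => ?_
  rw [Finset.mem_Icc] at hk
  rw [chi, sigma, div_mul_div_comm, ← pow_add, Nat.add_sub_cancel' hk.2]

theorem chi_perp (f : K[X] → ℂ) (n k : ℕ) : chi (perp f n) k = if k < n then chi f k else 0 := by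
  have : ∑ G ∈ monics K k, lambda (perp f n) G =
      if k < n then ∑ G ∈ monics K k, lambda f G else 0 := by
    rw [Finset.sum_congr rfl fun G hG => by rw [lambda_perp, (mem_monics.mp hG).2]]
    split_ifs <;> simp
  rw [chi, this]
  split_ifs
  · rfl
  · simp

theorem sigma_perp {f : K[X] → ℂ} (n j : ℕ) :
    sigma (perp f n) j = PowerSeries.coeff j (expSeries (chi f) n) := by
  have h1 := isExpSeq_sigma (isMultiplicative_perp f n) (ofLambda_one _)
  exact h1.unique (isExpSeq_expSeries (chi f) n) (n := j + 1) (fun k _ _ => chi_perp f n k) j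
    (Nat.lt_succ_self j)

/-! ### The generating function of `f^⊥` -/

/-- The mean value of `|f|` over monic polynomials of degree `j`. -/
def sigmaNorm (f : K[X] → ℂ) (j : ℕ) : ℝ := (∑ F ∈ monics K j, ‖f F‖) / (Nat.card K : ℝ) ^ j

/-- The recursion for norms is an inequality with nonnegative terms, hence is majorised by the case
χ = 1. This supplies the absolute convergence of ℱ^⊥. -/
theorem sigmaNorm_perp_le {f : K[X] → ℂ} (hf : InClass 1 f) (n j : ℕ) :
    sigmaNorm (perp f n) j ≤ (PowerSeries.coeff j (expSeries (fun _ => 1) n)).re := by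
  induction j using Nat.strong_induction_on with
  | _ j ih =>
    rcases Nat.eq_zero_or_pos j with rfl | hj
    · rw [coeff_expSeries_zero, sigmaNorm, monics_zero, Finset.sum_singleton, perp, ofLambda_one]
      simp
    · have hj0 : (0 : ℝ) < j := by exact_mod_cast hj
      have hq := natCard_pos (K := K)
      refine le_of_mul_le_mul_left ?_ hj0
      have h1 := congrArg Complex.re (coeff_expSeries_rec (fun _ => 1) n j)
      rw [← Complex.ofReal_natCast, Complex.re_ofReal_mul, Complex.re_sum] at h1
      rw [h1, sigmaNorm, mul_div_assoc']
      have h2 := natCast_mul_sum_norm_monics_le (isMultiplicative_perp f n) (ofLambda_one _) j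
      refine (div_le_div_of_nonneg_right h2 (pow_pos hq j).le).trans ?_
      rw [Finset.sum_div]
      refine Finset.sum_le_sum fun k hk => ?_
      rw [Finset.mem_Icc] at hk
      have h3 : ∑ G ∈ monics K k, ‖lambda (perp f n) G‖ ≤
          if k < n then (Nat.card K : ℝ) ^ k else 0 := by
        rw [Finset.sum_congr rfl fun G hG => by rw [lambda_perp, (mem_monics.mp hG).2]]
        split_ifs
        · exact sum_norm_lambda_le hf k
        · simp
      have h4 := ih (j - k) (by omega)
      have h5 : 0 ≤ ∑ H ∈ monics K (j - k), ‖perp f n H‖ := Finset.sum_nonneg fun _ _ => norm_nonneg _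
      have h6 : (Nat.card K : ℝ) ^ j = (Nat.card K : ℝ) ^ k * (Nat.card K : ℝ) ^ (j - k) := by
        rw [← pow_add, Nat.add_sub_cancel' hk.2]
      calc (∑ G ∈ monics K k, ‖lambda (perp f n) G‖) * (∑ H ∈ monics K (j - k), ‖perp f n H‖) /
            (Nat.card K : ℝ) ^ j
          ≤ (if k < n then (Nat.card K : ℝ) ^ k else 0) * (∑ H ∈ monics K (j - k), ‖perp f n H‖) /
            (Nat.card K : ℝ) ^ j := by gcongr
        _ = if k < n then sigmaNorm (perp f n) (j - k) else 0 := by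
            rw [h6, sigmaNorm]
            split_ifs
            · field_simp
            · simp
        _ ≤ _ := by
            split_ifs
            · simpa using h4
            · simp

/-- The monic polynomials, sorted by degree. -/
def sigmaMonicsEquiv : (Σ j : ℕ, monics K j) ≃ {F : K[X] // F.Monic} where
  toFun x := ⟨x.2, (mem_monics.mp x.2.2).1⟩
  invFun F := ⟨F.1.natDegree, F.1, mem_monics.mpr ⟨F.2, rfl⟩⟩
  left_inv := by
    rintro ⟨j, F, hF⟩
    obtain ⟨h1, rfl⟩ := mem_monics.mp hF
    rfl
  right_inv _ := rfl

/-- The unordered sum over polynomials may be grouped by degree because it converges absolutely; the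
coefficients are then those of `expSeries`. -/
theorem genFun_perp {f : K[X] → ℂ} (hf : InClass 1 f) (n : ℕ) {w : ℂ} (hw : ‖w‖ = 1) :
    genFun (perp f n) (w / (Nat.card K : ℂ)) =
      Complex.exp (∑ k ∈ Finset.Ico 1 n, chi f k * w ^ k / k) := by
  set g := perp f n with hg
  set z : ℂ := w / (Nat.card K : ℂ) with hz
  have hzn : ‖z‖ = 1 / (Nat.card K : ℝ) := by
    rw [hz, norm_div, hw, Complex.norm_natCast]
  have hterm : ∀ x : (Σ j : ℕ, monics K j), g (sigmaMonicsEquiv x) *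
      z ^ (sigmaMonicsEquiv x : K[X]).natDegree = g x.2 * z ^ x.1 := by
    rintro ⟨j, F, hF⟩
    obtain ⟨h1, rfl⟩ := mem_monics.mp hF
    rfl
  have hsum : Summable fun x : (Σ j : ℕ, monics K j) => ‖g x.2 * z ^ x.1‖ := by
    rw [summable_sigma_of_nonneg fun _ => norm_nonneg _]
    refine ⟨fun j => Summable.of_finite, ?_⟩
    have h1 := (absConverges_expSeries (fun _ => 1) n 1).1
    refine Summable.of_nonneg_of_le (fun j => tsum_nonneg fun _ => norm_nonneg _) (fun j => ?_) h1
    rw [one_pow, mul_one, tsum_fintype]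
    refine le_trans ?_ ((sigmaNorm_perp_le hf n j).trans (Complex.re_le_norm _))
    rw [Finset.sum_coe_sort (monics K j) (fun F => ‖g F * z ^ j‖), sigmaNorm, Finset.sum_div]
    refine Finset.sum_le_sum fun F _ => ?_
    rw [norm_mul, norm_pow, hzn, one_div, inv_pow, div_eq_mul_inv]
  rw [genFun, ← sigmaMonicsEquiv.tsum_eq, tsum_congr hterm, hsum.of_norm.tsum_sigma,
    ← (absConverges_expSeries (chi f) n w).2]
  refine tsum_congr fun j => ?_
  rw [tsum_fintype, Finset.sum_coe_sort (monics K j) (fun F => g F * z ^ j), ← sigma_perp, sigma,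
    ← Finset.sum_mul, hz, div_pow]
  ring

/-! ### Rotation of the maximum to z = 1. -/

/-- Twisting is the substitution of e(-θ)z for z, compatible with the recursion because the
character is additive in the degree. -/
theorem IsExpSeq.twist {χ σ : ℕ → ℂ} (h : IsExpSeq χ σ) (θ : ℝ) :
    IsExpSeq (fun k => χ k * e (-(k * θ))) (fun k => σ k * e (-(k * θ))) := by
  refine ⟨by simp [h.1, e_zero], fun j => ?_⟩
  rw [← mul_assoc, h.2, Finset.sum_mul]
  refine Finset.sum_congr rfl fun k hk => ?_
  rw [Finset.mem_Icc] at hk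
  have : -(j * θ) = -(k * θ) + -((j - k : ℕ) * θ) := by
    rw [Nat.cast_sub hk.2]; ring
  rw [this, e_add]
  ring

theorem e_neg_mul_fract (k : ℕ) (x : ℝ) : e (-Int.fract x) ^ k = e (-(k * x)) := by
  rw [← e_mul_nat]
  have : -(k * x) = k * -Int.fract x + ((-(k * ⌊x⌋) : ℤ) : ℝ) := by
    rw [Int.fract]; push_cast; ring
  rw [this, e_add, e_int, mul_one]

end FunctionFieldMean

end

/-! ### Deduction of the theorem from the estimate for sequences. -/

theorem mainTheorem3 :
    ∃ C A : ℝ, 0 < C ∧ 0 < A ∧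
      ∀ (K : Type*) [Field K] [Finite K] (f : Polynomial K → ℂ),
        FunctionFieldMean.InClass 1 f →
        ∀ n : ℕ, 2 ≤ n →
        ∀ θ ∈ Set.Ico (0 : ℝ) 1,
          IsMaxOn
            (fun t : ℝ => ‖FunctionFieldMean.genFun (FunctionFieldMean.perp f n)
              (FunctionFieldMean.e (-t) / (Nat.card K : ℂ))‖) (Set.Ico (0 : ℝ) 1) θ →
        ∀ l : ℕ, 1 ≤ l → l ≤ n →
        ∀ m : ℕ, IsLeast {k : ℕ | Odd k ∧ ¬ k ∣ l} m →
          ‖FunctionFieldMean.sigmaTwist f θ (n + l) - FunctionFieldMean.sigmaTwist f θ n‖ ≤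
            C * (((l : ℝ) / n) ^ (1 - 2 / Real.pi) * Real.log (2 * n / l)
              + Real.log n ^ A / (n : ℝ) ^ (1 - FunctionFieldMean.c m)) := by
  obtain ⟨C, A, hC, hA, h⟩ := FunctionFieldMean.exists_norm_sub_shift_le
  refine ⟨C, A, hC, hA, ?_⟩
  intro K _ _ f hf n hn θ hθ hmax l hl hln m hm
  have hσ := (FunctionFieldMean.isExpSeq_sigma hf.mult hf.map_one).twist θ
  refine h _ _ hσ (fun k => ?_) n hn (fun α => ?_) l hl hln m hm
  · rw [norm_mul, FunctionFieldMean.norm_e, mul_one]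
    exact FunctionFieldMean.norm_chi_le_one hf k
  -- The point e(α) of the twisted function corresponds to the angle θ - α, reduced modulo 1 to lie
  -- in [0, 1).
  · have h1 := isMaxOn_iff.mp hmax (Int.fract (θ - α)) ⟨Int.fract_nonneg _, Int.fract_lt_one _⟩
    rw [FunctionFieldMean.genFun_perp hf n (FunctionFieldMean.norm_e _),
      FunctionFieldMean.genFun_perp hf n (FunctionFieldMean.norm_e _)] at h1
    convert! h1 using 3
    · refine Finset.sum_congr rfl fun k _ => ?_
      rw [FunctionFieldMean.e_neg_mul_fract, mul_assoc, ← FunctionFieldMean.e_add]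
      ring_nf
    · refine Finset.sum_congr rfl fun k _ => ?_
      rw [← FunctionFieldMean.e_mul_nat, mul_neg]
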